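/- Let $c\ge 1$ be an integer, $\mu>0$, $\theta\ge 0$, and let $\lambda:[0,\infty)\to[0,\infty)$ be locally integrable. Let $Q=(Q(t))_{t\ge 0}$ be the queue length process of the $M(t)/M/c+M$ (non-stationary Erlang-A) queue with arrival rate $\lambda(t)$, $c$ servers, service rate $\mu$ and abandonment rate $\theta$, i.e. a right-continuous process with values in $\{0,1,2,\dots\}$ such that almost surely, for all $t\ge 0$, $$Q(t)=Q(0)+\Pi_1\Big(\int_0^t\lambda(s)\,ds\Big)-\Pi_2\Big(\int_0^t\mu\,(Q(s)\wedge c)\,ds\Big)-\Pi_3\Big(\int_0^t\theta\,(Q(s)-c)^+\,ds\Big),$$ where $\Pi_1,\Pi_2,\Pi_3$ are independent standard (rate 1) Poisson processes, independent of $Q(0)$, and $E[Q(0)]<\infty$ (for instance $Q(0)$ deterministic). Let $q$ be the fluid (mean-field) mean, i.e. a continuous function on $[0,\infty)$ that solves $$\dot q(t)=\lambda(t)-\mu\,(q(t)\wedge c)-\theta\,(q(t)-c)^+ ,\qquad q(0)=E[Q(0)],$$ in integrated form (at every $t$, if $\lambda$ is continuous). Then $E[Q(t)]<\infty$ for all $t\ge0$,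 and: * if $\theta<\mu$, then $E[Q(t)]\ge q(t)$ for all $t\ge 0$; * if $\theta>\mu$, then $E[Q(t)]\le q(t)$ for all $t\ge 0$; * if $\theta=\mu$, then $E[Q(t)]=q(t)$ for all $t\ge 0$. -/

import Mathlib

open MeasureTheory ProbabilityTheory
open scoped NNReal

/-- A standard (rate 1) Poisson process on `[0, ∞)`: it starts at `0`, its paths are nondecreasing
and right-continuous, its increments over disjoint intervals are independent, and
`N t - N s` has the Poisson law of mean `t - s` for `s ≤ t`.
Since the paths are nondecreasing, the subtraction of natural numbers does not truncate. -/
structure IsStandardPoissonProcess {Ω : Type*} [MeasurableSpace Ω] (P : Measure Ω)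
    (N : ℝ≥0 → Ω → ℕ) : Prop where
  measurable : ∀ t, Measurable (N t)
  zero : ∀ ω, N 0 ω = 0
  mono : ∀ ω, Monotone fun t => N t ω
  rightCts : ∀ ω t, ContinuousWithinAt (fun s => N s ω) (Set.Ici t) t
  indepIncrements : HasIndepIncrements N P
  law : ∀ s t : ℝ≥0, s ≤ t →
    HasLaw (fun ω => N t ω - N s ω) (poissonMeasure (t - s)) P

/-- The queue length process `Q` of the `M(t)/M/c+M` (non-stationary Erlang-A) queue with arrival
rate `lam`, `c` servers, service rate `μ` and abandonment rate `θ`: there are three independent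
standard Poisson processes `N 0, N 1, N 2`, independent of `Q 0`, such that almost surely, for all
`t ≥ 0`,
`Q t = Q 0 + N 0 (∫₀ᵗ lam s ds) - N 1 (∫₀ᵗ μ (Q s ∧ c) ds) - N 2 (∫₀ᵗ θ (Q s - c)⁺ ds)`. -/
structure IsErlangAQueue {Ω : Type*} [MeasurableSpace Ω] (P : Measure Ω)
    (lam : ℝ → ℝ) (c : ℕ) (μ θ : ℝ) (Q : ℝ≥0 → Ω → ℕ) : Prop where
  measurable : ∀ t, Measurable (Q t)
  rightCts : ∀ᵐ ω ∂P, ∀ t, ContinuousWithinAt (fun s => Q s ω) (Set.Ici t) t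
  timeChange : ∃ N : Fin 3 → ℝ≥0 → Ω → ℕ,
    (∀ i, IsStandardPoissonProcess P (N i)) ∧
    iIndepFun (fun i ω (t : ℝ≥0) => N i t ω) P ∧
    IndepFun (Q 0) (fun ω (i : Fin 3) (t : ℝ≥0) => N i t ω) P ∧
    ∀ᵐ ω ∂P, ∀ t : ℝ≥0,
      (Q t ω : ℝ) = (Q 0 ω : ℝ)
        + (N 0 (∫ s in (0 : ℝ)..t, lam s).toNNReal ω : ℝ)
        - (N 1 (∫ s in (0 : ℝ)..t, μ * min (Q s.toNNReal ω : ℝ) c).toNNReal ω : ℝ)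
        - (N 2 (∫ s in (0 : ℝ)..t, θ * max ((Q s.toNNReal ω : ℝ) - c) 0).toNNReal ω : ℝ)

/-- `q` solves on `[0, ∞)` the fluid (mean-field) equation
`q' = lam t - μ (q ∧ c) - θ (q - c)⁺`, in integrated form; for continuous `lam` this is the same
as the differential equation at every `t ≥ 0`. -/
structure IsFluidMean (lam : ℝ → ℝ) (c : ℕ) (μ θ : ℝ) (q : ℝ → ℝ) : Prop where
  continuousOn : ContinuousOn q (Set.Ici 0)
  integralEq : ∀ t : ℝ, 0 ≤ t →
    q t = q 0 + ∫ s in (0 : ℝ)..t, (lam s - μ * min (q s) c - θ * max (q s - c) 0)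

/-! Write D(x) = μ(x ∧ c) + θ(x - c)⁺ and m(t) = E[Q(t)]. Expectations in the time-change equation
give m' = λ - E[D(Q)] in integrated form (`mean_eq`). D is a minimum of two affine functions if θ ≤
μ and a maximum if μ ≤ θ, so Jensen's inequality compares E[D(Q)] with D(m)
(`integral_departureRate_le`, `le_integral_departureRate`). D is also nondecreasing. For θ ≤ μ,
wherever q > m, this gives E[D(Q)] ≤ D(m) ≤ D(q), so q - m cannot grow while it is positive, and it
starts at 0 (`solution_comparison`). The case μ ≤ θ is symmetric, and θ = μ is both at once.

The work lies in the expectations: a Poisson process N, evaluated at its internal clock τ, must have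
mean E[τ], although τ depends on N. If {a < τ} is independent of N(b) - N(a) for all a ≤ b, this
follows by summing over the cells of a grid and refining it (`integral_eval`). For the independence,
the queue is rebuilt from Q(0) and the driving paths as a jump chain. Stopping N at the level a does
not alter the chain as long as the clock has not passed a (`jumpChain_stopped_eq`). Hence {a < τ} is
almost surely an event of Q(0), the other two processes and N up to a (`lt_clock₁_iff`,
`indepLaterIncrements_clock`). -/

/-- A path is right-locally constant if it is constant on some interval `[s, s + ε)` for each `s`. -/
def RightLocallyConstant {α : Type*} (f : ℝ≥0 → α) : Prop :=
  ∀ s, ∃ ε > 0, ∀ r < ε, f (s + r) = f s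

theorem rightLocallyConstant_of_continuousWithinAt {f : ℝ≥0 → ℕ}
    (hf : ∀ t, ContinuousWithinAt f (Set.Ici t) t) : RightLocallyConstant f := by
  intro s
  have h : ∀ᶠ y in nhdsWithin s (Set.Ici s), f y = f s := by
    have := (hf s).eventually (IsOpen.mem_nhds (isOpen_discrete {f s}) rfl)
    exact this
  rw [eventually_nhdsWithin_iff, Metric.eventually_nhds_iff] at h
  obtain ⟨ε, hε, h⟩ := h
  refine ⟨⟨ε, hε.le⟩, hε, fun r hr => h ?_ (by simp)⟩
  rw [NNReal.dist_eq]
  push_cast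
  rw [add_sub_cancel_left, abs_of_nonneg r.coe_nonneg]
  exact hr

theorem RightLocallyConstant.comp_affine {α : Type*} {f : ℝ≥0 → α} (hf : RightLocallyConstant f)
    (a c : ℝ≥0) : RightLocallyConstant fun r => f (a + c * r) := by
  intro s
  obtain ⟨ε, hε, h⟩ := hf (a + c * s)
  refine ⟨ε / (c + 1), by positivity, fun r hr => ?_⟩
  have h1 : c * r < ε := by
    rw [lt_div_iff₀ (by positivity)] at hr
    calc c * r ≤ r * (c + 1) := by rw [mul_add, mul_one, mul_comm]; exact le_self_add
      _ < ε := hr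
  have := h _ h1
  simpa only [mul_add, add_assoc] using this

theorem RightLocallyConstant.comp_min {α : Type*} {f : ℝ≥0 → α} (hf : RightLocallyConstant f)
    (a : ℝ≥0) : RightLocallyConstant fun r => f (min r a) := by
  intro s
  rcases lt_or_ge s a with hs | hs
  · obtain ⟨ε, hε, h⟩ := hf s
    refine ⟨min ε (a - s), lt_min hε (tsub_pos_of_lt hs), fun r hr => ?_⟩
    have h2 : s + r ≤ a := by
      have := (hr.trans_le (min_le_right _ _)).le
      rw [add_comm]
      exact (le_tsub_iff_right hs.le).1 this
    simp only [min_eq_left h2, min_eq_left hs.le]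
    exact h r (hr.trans_le (min_le_left _ _))
  · refine ⟨1, one_pos, fun r _ => ?_⟩
    simp only [min_eq_right hs, min_eq_right (hs.trans le_self_add)]

theorem RightLocallyConstant.map₃ {α β γ δ : Type*} {f : ℝ≥0 → α} {g : ℝ≥0 → β} {h : ℝ≥0 → γ}
    (hf : RightLocallyConstant f) (hg : RightLocallyConstant g) (hh : RightLocallyConstant h)
    (F : α → β → γ → δ) : RightLocallyConstant fun r => F (f r) (g r) (h r) := by
  intro s
  obtain ⟨ε, hε, h1⟩ := hf s
  obtain ⟨ε', hε', h2⟩ := hg s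
  obtain ⟨ε'', hε'', h3⟩ := hh s
  refine ⟨min ε (min ε' ε''), by positivity, fun r hr => ?_⟩
  simp only [lt_min_iff] at hr
  simp only [h1 r hr.1, h2 r hr.2.1, h3 r hr.2.2]

/-! ### Dwell times -/

/-- `d` is the time for which `f` stays at `x`, capped by `u`. -/
structure IsDwellTime (f : ℝ≥0 → ℕ) (x : ℕ) (u d : ℝ≥0) : Prop where
  le : d ≤ u
  eq_of_lt : ∀ r < d, f r = x
  eq_or_ne : d = u ∨ f d ≠ x

theorem IsDwellTime.not_lt {f : ℝ≥0 → ℕ} {x : ℕ} {u d d' : ℝ≥0} (h : IsDwellTime f x u d)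
    (h' : IsDwellTime f x u d') : ¬ d < d' := by
  intro hlt
  rcases h.eq_or_ne with e | e
  · exact absurd h'.le (not_le.2 (e ▸ hlt))
  · exact e (h'.eq_of_lt _ hlt)

theorem IsDwellTime.unique {f : ℝ≥0 → ℕ} {x : ℕ} {u d d' : ℝ≥0} (h : IsDwellTime f x u d)
    (h' : IsDwellTime f x u d') : d = d' :=
  le_antisymm (_root_.not_lt.1 (h'.not_lt h)) (_root_.not_lt.1 (h.not_lt h'))

theorem IsDwellTime.congr {f f' : ℝ≥0 → ℕ} {x : ℕ} {u d : ℝ≥0} (h : IsDwellTime f x u d)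
    (hff : ∀ r ≤ d, f r = f' r) : IsDwellTime f' x u d :=
  ⟨h.le, fun r hr => by rw [← hff r hr.le, h.eq_of_lt r hr], by
    rw [← hff d le_rfl]; exact h.eq_or_ne⟩

/-- The time for which `f` stays at `x`, capped by `u`, as an infimum over the rationals. -/
noncomputable def dwellTime (f : ℝ≥0 → ℕ) (x : ℕ) (u : ℝ≥0) : ℝ≥0 :=
  ⨅ k : ℚ≥0, if f k = x then u else min (k : ℝ≥0) u

theorem exists_nnrat_btwn {a b : ℝ≥0} (h : a < b) : ∃ k : ℚ≥0, a < k ∧ (k : ℝ≥0) < b := by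
  obtain ⟨q, h1, h2⟩ := exists_rat_btwn (show (a : ℝ) < b from h)
  have hq : 0 ≤ q := by
    have : (0 : ℝ) < q := a.2.trans_lt h1
    exact_mod_cast this.le
  refine ⟨⟨q, hq⟩, ?_, ?_⟩
  · rw [← NNReal.coe_lt_coe]; exact h1
  · rw [← NNReal.coe_lt_coe]; exact h2

/-- Rational times suffice because a value taken at a real time persists for a while to its right,
where a rational sees it. -/
theorem isDwellTime_dwellTime {f : ℝ≥0 → ℕ} (hf : RightLocallyConstant f) (x : ℕ) (u : ℝ≥0) :
    IsDwellTime f x u (dwellTime f x u) := by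
  have hb : BddBelow (Set.range fun k : ℚ≥0 => if f k = x then u else min (k : ℝ≥0) u) :=
    OrderBot.bddBelow _
  have hle : ∀ k : ℚ≥0, dwellTime f x u ≤ if f k = x then u else min (k : ℝ≥0) u :=
    fun k => ciInf_le hb k
  have h1 : dwellTime f x u ≤ u := (hle 0).trans (by split_ifs <;> simp)
  have h2 : ∀ r < dwellTime f x u, f r = x := by
    intro r hr
    obtain ⟨ε, hε, h⟩ := hf r
    obtain ⟨k, hk, hk'⟩ := exists_nnrat_btwn
      (show r < min (r + ε) (dwellTime f x u) from lt_min (by simpa using hε) hr)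
    have hfk : f k = x := by
      by_contra hne
      have := hle k
      rw [if_neg hne] at this
      exact absurd (this.trans (min_le_left _ _)) (not_le.2 (hk'.trans_le (min_le_right _ _)))
    have := h (k - r) (by
      rw [tsub_lt_iff_left hk.le]; exact hk'.trans_le (min_le_left _ _))
    rw [add_tsub_cancel_of_le hk.le] at this
    rw [← this, hfk]
  refine ⟨h1, h2, ?_⟩
  by_contra! hcon
  obtain ⟨hne, he⟩ := hcon
  have hlt := lt_of_le_of_ne h1 hne
  -- If the path were still at `x` at the infimum, it would stay there for a further `ε`, and the
  -- infimum would be larger.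
  obtain ⟨ε, hε, h⟩ := hf (dwellTime f x u)
  have : min (dwellTime f x u + ε) u ≤ dwellTime f x u := by
    refine le_ciInf fun k => ?_
    split_ifs with hk
    · exact min_le_right _ _
    · refine min_le_min ?_ le_rfl
      by_contra! hlt'
      rcases lt_or_ge (k : ℝ≥0) (dwellTime f x u) with h3 | h3
      · exact hk (h2 _ h3)
      · have := h (k - dwellTime f x u) (by rwa [tsub_lt_iff_left h3])
        rw [add_tsub_cancel_of_le h3] at this
        exact hk (this.trans he)
  exact absurd this (not_le.2 (lt_min (by simpa using hε) hlt))

/-! ### The jump chain as an explicit functional of the driving paths -/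

/-- A state of the jump chain: current time, value of the queue, and the two internal clocks. -/
@[ext] structure ChainState where
  time : ℝ≥0
  value : ℕ
  clock₁ : ℝ≥0
  clock₂ : ℝ≥0

namespace ChainState

/-- The path of the queue after the state `S`, with both clock rates frozen. -/
noncomputable def frozen (g n₁ n₂ : ℝ≥0 → ℕ) (r₁ r₂ : ℕ → ℝ≥0) (S : ChainState) (r : ℝ≥0) : ℕ :=
  g (S.time + 1 * r) - n₁ (S.clock₁ + r₁ S.value * r) - n₂ (S.clock₂ + r₂ S.value * r)

/-- The time until the next jump after the state `S`, stopped at the time horizon `t`. -/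
noncomputable def wait (g n₁ n₂ : ℝ≥0 → ℕ) (r₁ r₂ : ℕ → ℝ≥0) (t : ℝ≥0) (S : ChainState) : ℝ≥0 :=
  dwellTime (S.frozen g n₁ n₂ r₁ r₂) S.value (t - S.time)

/-- Move to the next jump time, or to the time horizon `t` if no jump occurs before it. -/
noncomputable def step (g n₁ n₂ : ℝ≥0 → ℕ) (r₁ r₂ : ℕ → ℝ≥0) (t : ℝ≥0) (S : ChainState) :
    ChainState where
  time := S.time + S.wait g n₁ n₂ r₁ r₂ t
  value := S.frozen g n₁ n₂ r₁ r₂ (S.wait g n₁ n₂ r₁ r₂ t)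
  clock₁ := S.clock₁ + r₁ S.value * S.wait g n₁ n₂ r₁ r₂ t
  clock₂ := S.clock₂ + r₂ S.value * S.wait g n₁ n₂ r₁ r₂ t

end ChainState

/-- The jump chain, up to the time horizon `t`, of the queue with arrivals `g` and departures
counted by `n₁` and `n₂`, whose clocks run at the rates `r₁` and `r₂`. -/
noncomputable def jumpChain (g n₁ n₂ : ℝ≥0 → ℕ) (r₁ r₂ : ℕ → ℝ≥0) (t : ℝ≥0) : ℕ → ChainState
  | 0 => ⟨0, g 0 - n₁ 0 - n₂ 0, 0, 0⟩
  | k + 1 => (jumpChain g n₁ n₂ r₁ r₂ t k).step g n₁ n₂ r₁ r₂ t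

theorem rightLocallyConstant_frozen {g n₁ n₂ : ℝ≥0 → ℕ} (hg : RightLocallyConstant g)
    (h₁ : RightLocallyConstant n₁) (h₂ : RightLocallyConstant n₂) (r₁ r₂ : ℕ → ℝ≥0)
    (S : ChainState) : RightLocallyConstant (S.frozen g n₁ n₂ r₁ r₂) :=
  -- The factor `1` in `frozen` gives the arrival term the same affine shape as the other two.
  (hg.comp_affine S.time 1).map₃ (h₁.comp_affine S.clock₁ (r₁ S.value))
    (h₂.comp_affine S.clock₂ (r₂ S.value)) fun a b c => a - b - c

section Stopped

variable {g n₁ n₂ : ℝ≥0 → ℕ} {r₁ r₂ : ℕ → ℝ≥0} {t : ℝ≥0}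

theorem ChainState.frozen_stopped_eq (S : ChainState) {a r : ℝ≥0}
    (h : S.clock₁ + r₁ S.value * r ≤ a) :
    S.frozen g n₁ n₂ r₁ r₂ r = S.frozen g (fun s => n₁ (min s a)) n₂ r₁ r₂ r := by
  simp [frozen, min_eq_left h]

/-- During the step the first clock stays at or below its final value. If that is at most `a`, the
two frozen paths agree up to and including the jump, so uniqueness of dwell times gives equal waits.
Either chain may supply the bound, since `lt_clock₁_iff` needs both directions. -/
theorem ChainState.step_stopped_eq (hg : RightLocallyConstant g)
    (h₁ : RightLocallyConstant n₁) (h₂ : RightLocallyConstant n₂) (S : ChainState) {a : ℝ≥0}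
    (h : (S.step g n₁ n₂ r₁ r₂ t).clock₁ ≤ a ∨
      (S.step g (fun s => n₁ (min s a)) n₂ r₁ r₂ t).clock₁ ≤ a) :
    S.step g n₁ n₂ r₁ r₂ t = S.step g (fun s => n₁ (min s a)) n₂ r₁ r₂ t := by
  have H := isDwellTime_dwellTime (rightLocallyConstant_frozen hg h₁ h₂ r₁ r₂ S) S.value
    (t - S.time)
  have H' := isDwellTime_dwellTime (rightLocallyConstant_frozen hg (h₁.comp_min a) h₂ r₁ r₂ S)
    S.value (t - S.time)
  have key : S.wait g n₁ n₂ r₁ r₂ t = S.wait g (fun s => n₁ (min s a)) n₂ r₁ r₂ t ∧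
      S.clock₁ + r₁ S.value * S.wait g n₁ n₂ r₁ r₂ t ≤ a := by
    rcases h with h | h
    · have e : S.wait g n₁ n₂ r₁ r₂ t = S.wait g (fun s => n₁ (min s a)) n₂ r₁ r₂ t := by
        refine (H.congr fun r hr => S.frozen_stopped_eq (a := a) (le_trans ?_ h)).unique H'
        simp only [step]
        gcongr
        exact hr
      exact ⟨e, h⟩
    · have e : S.wait g n₁ n₂ r₁ r₂ t = S.wait g (fun s => n₁ (min s a)) n₂ r₁ r₂ t := by
        refine H.unique (H'.congr fun r hr => (S.frozen_stopped_eq (a := a) (le_trans ?_ h)).symm)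
        simp only [step]
        gcongr
        exact hr
      exact ⟨e, e ▸ h⟩
  have e := S.frozen_stopped_eq (g := g) (n₁ := n₁) (n₂ := n₂) (r₂ := r₂) key.2
  simp only [step, ← key.1]
  rw [e]

/-- The clock never decreases along the chain, so the bound at step `k + 1` is inherited by step
`k`. -/
theorem jumpChain_stopped_eq (hg : RightLocallyConstant g)
    (h₁ : RightLocallyConstant n₁) (h₂ : RightLocallyConstant n₂) {a : ℝ≥0} (k : ℕ)
    (h : (jumpChain g n₁ n₂ r₁ r₂ t k).clock₁ ≤ a ∨
      (jumpChain g (fun s => n₁ (min s a)) n₂ r₁ r₂ t k).clock₁ ≤ a) :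
    jumpChain g n₁ n₂ r₁ r₂ t k = jumpChain g (fun s => n₁ (min s a)) n₂ r₁ r₂ t k := by
  induction k with
  | zero => simp [jumpChain]
  | succ k ih =>
    have ih' := ih (h.imp (fun h => le_trans (by simp [jumpChain, ChainState.step]) h)
      (fun h => le_trans (by simp [jumpChain, ChainState.step]) h))
    simp only [jumpChain, ← ih'] at h ⊢
    exact ChainState.step_stopped_eq hg h₁ h₂ _ h

end Stopped

/-! ### Queue paths follow the jump chain -/

/-- `Q` solves the time-change equation with arrivals `g`, departures counted by `n₁` and `n₂`,
and internal clocks `τ₁` and `τ₂` which run at the rates `r₁ (Q s)` and `r₂ (Q s)`. -/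
structure IsQueuePath (g n₁ n₂ : ℝ≥0 → ℕ) (r₁ r₂ : ℕ → ℝ≥0) (τ₁ τ₂ : ℝ≥0 → ℝ≥0)
    (Q : ℝ≥0 → ℕ) : Prop where
  rlc_arrival : RightLocallyConstant g
  rlc₁ : RightLocallyConstant n₁
  rlc₂ : RightLocallyConstant n₂
  rlc : RightLocallyConstant Q
  mono_arrival : Monotone g
  mono₁ : Monotone n₁
  mono₂ : Monotone n₂
  mono_clock₁ : Monotone τ₁
  mono_clock₂ : Monotone τ₂
  clock₁_zero : τ₁ 0 = 0
  clock₂_zero : τ₂ 0 = 0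
  clock₁_add : ∀ s r x, (∀ u < r, Q (s + u) = x) → τ₁ (s + r) = τ₁ s + r₁ x * r
  clock₂_add : ∀ s r x, (∀ u < r, Q (s + u) = x) → τ₂ (s + r) = τ₂ s + r₂ x * r
  eq : ∀ s, Q s = g s - n₁ (τ₁ s) - n₂ (τ₂ s)

namespace IsQueuePath

variable {g n₁ n₂ : ℝ≥0 → ℕ} {r₁ r₂ : ℕ → ℝ≥0} {τ₁ τ₂ : ℝ≥0 → ℝ≥0} {Q : ℝ≥0 → ℕ}

/-- Results are proved for the first clock only; the symmetry carries them to the second. -/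
theorem swap (h : IsQueuePath g n₁ n₂ r₁ r₂ τ₁ τ₂ Q) : IsQueuePath g n₂ n₁ r₂ r₁ τ₂ τ₁ Q where
  rlc_arrival := h.rlc_arrival
  rlc₁ := h.rlc₂
  rlc₂ := h.rlc₁
  rlc := h.rlc
  mono_arrival := h.mono_arrival
  mono₁ := h.mono₂
  mono₂ := h.mono₁
  mono_clock₁ := h.mono_clock₂
  mono_clock₂ := h.mono_clock₁
  clock₁_zero := h.clock₂_zero
  clock₂_zero := h.clock₁_zero
  clock₁_add := h.clock₂_add
  clock₂_add := h.clock₁_add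
  eq s := by rw [h.eq s, tsub_right_comm]

/-- The state of the chain that belongs to the queue path `Q` at time `s`. -/
def stateAt (τ₁ τ₂ : ℝ≥0 → ℝ≥0) (Q : ℝ≥0 → ℕ) (s : ℝ≥0) : ChainState := ⟨s, Q s, τ₁ s, τ₂ s⟩

/-- While `Q` is constant the clocks are affine, so the frozen path solves the true equation, up to
and including the first possible jump. -/
theorem frozen_eq (h : IsQueuePath g n₁ n₂ r₁ r₂ τ₁ τ₂ Q) {s r : ℝ≥0}
    (hr : ∀ u < r, Q (s + u) = Q s) :
    (stateAt τ₁ τ₂ Q s).frozen g n₁ n₂ r₁ r₂ r = Q (s + r) := by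
  simp only [ChainState.frozen, stateAt, one_mul]
  rw [← h.clock₁_add s r _ hr, ← h.clock₂_add s r _ hr, ← h.eq]

theorem eq_of_lt_wait (h : IsQueuePath g n₁ n₂ r₁ r₂ τ₁ τ₂ Q) {s t : ℝ≥0} :
    ∀ r < (stateAt τ₁ τ₂ Q s).wait g n₁ n₂ r₁ r₂ t, Q (s + r) = Q s := by
  set S := stateAt τ₁ τ₂ Q s
  set d := S.wait g n₁ n₂ r₁ r₂ t with hd
  have H := isDwellTime_dwellTime
    (rightLocallyConstant_frozen h.rlc_arrival h.rlc₁ h.rlc₂ r₁ r₂ S) S.value (t - S.time)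
  by_contra! hcon
  obtain ⟨r, hr, hne⟩ := hcon
  -- At the first time `sInf B` of disagreement the frozen path still equals `Q`, hence `Q s`.
  -- Right-local constancy then pushes the disagreement strictly later.
  set B : Set ℝ≥0 := {r | Q (s + r) ≠ Q s} with hB
  have hBn : B.Nonempty := ⟨r, hne⟩
  have hρr : sInf B ≤ r := csInf_le (OrderBot.bddBelow _) hne
  have hbelow : ∀ u < sInf B, Q (s + u) = Q s := by
    intro u hu
    by_contra hne'
    exact absurd (csInf_le (OrderBot.bddBelow _) (show u ∈ B from hne')) (not_le.2 hu)
  have hat : Q (s + sInf B) = Q s := by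
    rw [← h.frozen_eq hbelow]
    exact H.eq_of_lt _ (hρr.trans_lt hr)
  obtain ⟨ε, hε, hloc⟩ := h.rlc (s + sInf B)
  obtain ⟨b, hb, hb'⟩ := exists_lt_of_csInf_lt hBn (show sInf B < sInf B + ε by simpa using hε)
  have hle : sInf B ≤ b := csInf_le (OrderBot.bddBelow _) hb
  have := hloc (b - sInf B) (by rwa [tsub_lt_iff_left hle])
  rw [add_assoc, add_tsub_cancel_of_le hle] at this
  exact hb (this.trans hat)

theorem step_stateAt (h : IsQueuePath g n₁ n₂ r₁ r₂ τ₁ τ₂ Q) (s t : ℝ≥0) :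
    (stateAt τ₁ τ₂ Q s).step g n₁ n₂ r₁ r₂ t =
      stateAt τ₁ τ₂ Q (s + (stateAt τ₁ τ₂ Q s).wait g n₁ n₂ r₁ r₂ t) := by
  have hlt := h.eq_of_lt_wait (s := s) (t := t)
  ext
  · rfl
  · simp only [ChainState.step, h.frozen_eq hlt]; rfl
  · exact congrArg NNReal.toReal (h.clock₁_add _ _ _ hlt).symm
  · exact congrArg NNReal.toReal (h.clock₂_add _ _ _ hlt).symm

theorem jumpChain_eq (h : IsQueuePath g n₁ n₂ r₁ r₂ τ₁ τ₂ Q) (t : ℝ≥0) (k : ℕ) :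
    jumpChain g n₁ n₂ r₁ r₂ t k = stateAt τ₁ τ₂ Q (jumpChain g n₁ n₂ r₁ r₂ t k).time ∧
      (jumpChain g n₁ n₂ r₁ r₂ t k).time ≤ t := by
  induction k with
  | zero =>
    refine ⟨?_, by simp [jumpChain]⟩
    simp [jumpChain, stateAt, h.clock₁_zero, h.clock₂_zero, h.eq 0]
  | succ k ih =>
    obtain ⟨ih, hle⟩ := ih
    set s := (jumpChain g n₁ n₂ r₁ r₂ t k).time
    have e : jumpChain g n₁ n₂ r₁ r₂ t (k + 1) =
        stateAt τ₁ τ₂ Q (s + (stateAt τ₁ τ₂ Q s).wait g n₁ n₂ r₁ r₂ t) := by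
      rw [jumpChain, ih, h.step_stateAt]
    refine ⟨by rw [e]; rfl, ?_⟩
    rw [e]
    have := (isDwellTime_dwellTime (rightLocallyConstant_frozen h.rlc_arrival h.rlc₁ h.rlc₂ r₁ r₂
      (stateAt τ₁ τ₂ Q s)) (stateAt τ₁ τ₂ Q s).value (t - s)).le
    calc s + (stateAt τ₁ τ₂ Q s).wait g n₁ n₂ r₁ r₂ t ≤ s + (t - s) := by gcongr; exact this
      _ = t := add_tsub_cancel_of_le hle

/-- The chain does not explode: a step that stops short of `t` changes `Q`, so it raises the total
number of events `F`, which is bounded by its value at `t`. -/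
theorem exists_jumpChain_time_eq (h : IsQueuePath g n₁ n₂ r₁ r₂ τ₁ τ₂ Q) (t : ℝ≥0) :
    ∃ k, (jumpChain g n₁ n₂ r₁ r₂ t k).time = t := by
  by_contra! hne
  set T : ℕ → ℝ≥0 := fun k => (jumpChain g n₁ n₂ r₁ r₂ t k).time with hT
  have hlt : ∀ k, T k < t := fun k => lt_of_le_of_ne (h.jumpChain_eq t k).2 (hne k)
  set F : ℝ≥0 → ℕ := fun s => g s + n₁ (τ₁ s) + n₂ (τ₂ s)
  have hstep : ∀ k, F (T k) < F (T (k + 1)) := by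
    intro k
    obtain ⟨ih, -⟩ := h.jumpChain_eq t k
    change _ = stateAt τ₁ τ₂ Q (T k) at ih
    have e : jumpChain g n₁ n₂ r₁ r₂ t (k + 1) =
        stateAt τ₁ τ₂ Q (T k + (stateAt τ₁ τ₂ Q (T k)).wait g n₁ n₂ r₁ r₂ t) := by
      rw [jumpChain, ih, h.step_stateAt]
    have e' : T (k + 1) = T k + (stateAt τ₁ τ₂ Q (T k)).wait g n₁ n₂ r₁ r₂ t := by
      simp only [hT, e]; rfl
    have hd := (isDwellTime_dwellTime (rightLocallyConstant_frozen h.rlc_arrival h.rlc₁ h.rlc₂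
      r₁ r₂ (stateAt τ₁ τ₂ Q (T k))) (stateAt τ₁ τ₂ Q (T k)).value (t - T k)).eq_or_ne
    have hQ : Q (T (k + 1)) ≠ Q (T k) := by
      rcases hd with hd | hd
      · have := hlt (k + 1)
        rw [e', ChainState.wait, show (stateAt τ₁ τ₂ Q (T k)).time = T k from rfl, hd,
          add_tsub_cancel_of_le (hlt k).le] at this
        exact absurd this (lt_irrefl _)
      · rw [e', ← h.frozen_eq h.eq_of_lt_wait]
        exact hd
    have hle : T k ≤ T (k + 1) := by rw [e']; exact le_self_add
    have m0 := h.mono_arrival hle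
    have m1 := h.mono₁ (h.mono_clock₁ hle)
    have m2 := h.mono₂ (h.mono_clock₂ hle)
    rw [h.eq, h.eq (T k)] at hQ
    simp only [F]
    omega
  have hmono : StrictMono fun k => F (T k) := strictMono_nat_of_lt_succ hstep
  have hbound : F (T (F t + 1)) ≤ F t := by
    have := (hlt (F t + 1)).le
    have m0 := h.mono_arrival this
    have m1 := h.mono₁ (h.mono_clock₁ this)
    have m2 := h.mono₂ (h.mono_clock₂ this)
    simp only [F] at *
    omega
  have := hmono.le_apply (x := F t + 1)
  omega

/-- Whether the first clock exceeds the level `a` before time `t` depends on the first counting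
path only through its values up to `a`. -/
theorem lt_clock₁_iff (h : IsQueuePath g n₁ n₂ r₁ r₂ τ₁ τ₂ Q) (t a : ℝ≥0) :
    a < τ₁ t ↔ ∃ k, a < (jumpChain g (fun s => n₁ (min s a)) n₂ r₁ r₂ t k).clock₁ := by
  have hiff : ∀ k, a < (jumpChain g n₁ n₂ r₁ r₂ t k).clock₁ ↔
      a < (jumpChain g (fun s => n₁ (min s a)) n₂ r₁ r₂ t k).clock₁ := by
    intro k
    rw [← not_le, ← not_le, not_iff_not]
    constructor
    · intro hk
      rwa [← jumpChain_stopped_eq h.rlc_arrival h.rlc₁ h.rlc₂ k (Or.inl hk)]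
    · intro hk
      rwa [jumpChain_stopped_eq h.rlc_arrival h.rlc₁ h.rlc₂ k (Or.inr hk)]
  simp only [← hiff]
  constructor
  · intro ha
    obtain ⟨k, hk⟩ := h.exists_jumpChain_time_eq t
    refine ⟨k, ?_⟩
    rw [(h.jumpChain_eq t k).1, hk]
    exact ha
  · rintro ⟨k, hk⟩
    obtain ⟨e, hle⟩ := h.jumpChain_eq t k
    rw [e] at hk
    exact hk.trans_le (h.mono_clock₁ hle)

end IsQueuePath

/-! ### Grid approximation and measurability at random times -/

/-- The first point of the grid of mesh `1 / (n + 1)` that is not before `s`. -/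
noncomputable def gridAbove (n : ℕ) (s : ℝ≥0) : ℝ≥0 := (⌈((n : ℝ≥0) + 1) * s⌉₊ : ℝ≥0) / (n + 1)

theorem le_gridAbove (n : ℕ) (s : ℝ≥0) : s ≤ gridAbove n s := by
  rw [gridAbove, le_div_iff₀ (by positivity), mul_comm]
  exact Nat.le_ceil _

theorem gridAbove_le_add (n : ℕ) (s : ℝ≥0) : gridAbove n s ≤ s + 1 / (n + 1) := by
  have h : (0 : ℝ≥0) < n + 1 := by positivity
  have e : (s + 1 / ((n : ℝ≥0) + 1)) * (n + 1) = (n + 1) * s + 1 := by field_simp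
  rw [gridAbove, div_le_iff₀ h, e]
  exact (Nat.ceil_lt_add_one (by positivity)).le

/-- Natural numbers lie on every grid. The grid of mesh `1` therefore dominates all the others,
which yields the majorant in `integral_eval_of_measurable`. -/
theorem gridAbove_le_ceil (n : ℕ) (s : ℝ≥0) : gridAbove n s ≤ (⌈s⌉₊ : ℝ≥0) := by
  have h : (0 : ℝ≥0) < n + 1 := by positivity
  rw [gridAbove, div_le_iff₀ h]
  have : ⌈((n : ℝ≥0) + 1) * s⌉₊ ≤ ⌈s⌉₊ * (n + 1) := by
    refine Nat.ceil_le.2 ?_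
    push_cast
    rw [mul_comm]
    gcongr
    exact Nat.le_ceil s
  exact_mod_cast this

theorem RightLocallyConstant.eventually_gridAbove {α : Type*} {f : ℝ≥0 → α}
    (hf : RightLocallyConstant f) (s : ℝ≥0) :
    ∀ᶠ n in Filter.atTop, f (gridAbove n s) = f s := by
  obtain ⟨ε, hε, h⟩ := hf s
  obtain ⟨n₀, hn₀⟩ := exists_nat_one_div_lt (show (0 : ℝ) < ε from hε)
  have hn₀' : 1 / ((n₀ : ℝ≥0) + 1) < ε := by
    rw [← NNReal.coe_lt_coe]; push_cast; exact hn₀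
  filter_upwards [Filter.eventually_ge_atTop n₀] with n hn
  have h1 : 1 / ((n : ℝ≥0) + 1) ≤ 1 / ((n₀ : ℝ≥0) + 1) := by gcongr
  have := h (gridAbove n s - s) (by
    rw [tsub_lt_iff_left (le_gridAbove n s)]
    exact (gridAbove_le_add n s).trans_lt (by gcongr; exact h1.trans_lt hn₀'))
  rwa [add_tsub_cancel_of_le (le_gridAbove n s)] at this

section

variable {Ω : Type*} {m : MeasurableSpace Ω}

theorem measurable_eval_index {F : ℕ → Ω → ℕ} (hF : ∀ k, Measurable (F k)) {K : Ω → ℕ}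
    (hK : Measurable K) : Measurable fun ω => F (K ω) ω :=
  (measurable_from_prod_countable_right (f := fun p : ℕ × Ω => F p.1 p.2) hF).comp
    (hK.prodMk measurable_id)

theorem measurable_eval_gridAbove {N : ℝ≥0 → Ω → ℕ} (hN : ∀ s, Measurable (N s))
    {A : Ω → ℝ≥0} (hA : Measurable A) (n : ℕ) : Measurable fun ω => N (gridAbove n (A ω)) ω := by
  have hk : Measurable fun ω => ⌈((n : ℝ≥0) + 1) * A ω⌉₊ := Nat.measurable_ceil.comp (by fun_prop)
  simp only [gridAbove]
  exact measurable_eval_index (F := fun k => N ((k : ℝ≥0) / (n + 1))) (fun k => hN _) hk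

/-- Evaluation on a grid involves countably many times only, and the grid values are eventually
equal to the limit because they are taken from the right. -/
theorem measurable_eval_of_rightLocallyConstant {N : ℝ≥0 → Ω → ℕ} (hN : ∀ s, Measurable (N s))
    (hr : ∀ ω, RightLocallyConstant fun s => N s ω) {A : Ω → ℝ≥0} (hA : Measurable A) :
    Measurable fun ω => N (A ω) ω := by
  refine measurable_of_tendsto_metrizable (fun n => measurable_eval_gridAbove hN hA n) ?_
  rw [tendsto_pi_nhds]
  intro ω
  exact tendsto_const_nhds.congr' (((hr ω).eventually_gridAbove (A ω)).mono fun n h => h.symm)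

theorem measurable_clock_jumpChain {g n₁ n₂ : ℝ≥0 → Ω → ℕ} (hg : ∀ s, Measurable (g s))
    (h₁ : ∀ s, Measurable (n₁ s)) (h₂ : ∀ s, Measurable (n₂ s))
    (hgr : ∀ ω, RightLocallyConstant fun s => g s ω)
    (h₁r : ∀ ω, RightLocallyConstant fun s => n₁ s ω)
    (h₂r : ∀ ω, RightLocallyConstant fun s => n₂ s ω) (r₁ r₂ : ℕ → ℝ≥0) (t : ℝ≥0) (k : ℕ) :
    Measurable fun ω => (jumpChain (g · ω) (n₁ · ω) (n₂ · ω) r₁ r₂ t k).clock₁ := by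
  set S : Ω → ℕ → ChainState := fun ω k => jumpChain (g · ω) (n₁ · ω) (n₂ · ω) r₁ r₂ t k with hS
  -- Each coordinate of a step depends on the others, so all four go through the induction together.
  suffices h : (Measurable fun ω => (S ω k).time) ∧ (Measurable fun ω => (S ω k).value) ∧
      (Measurable fun ω => (S ω k).clock₁) ∧ Measurable fun ω => (S ω k).clock₂ from h.2.2.1
  induction k with
  | zero =>
    simp only [hS, jumpChain]
    exact ⟨measurable_const, ((hg 0).sub (h₁ 0)).sub (h₂ 0), measurable_const, measurable_const⟩
  | succ k ih =>
    obtain ⟨hT, hv, hA, hB⟩ := ih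
    have hr₁ : Measurable fun ω => r₁ (S ω k).value := (measurable_of_countable r₁).comp hv
    have hr₂ : Measurable fun ω => r₂ (S ω k).value := (measurable_of_countable r₂).comp hv
    have hF : ∀ d : Ω → ℝ≥0, Measurable d →
        Measurable fun ω => (S ω k).frozen (g · ω) (n₁ · ω) (n₂ · ω) r₁ r₂ (d ω) := by
      intro d hd
      simp only [ChainState.frozen]
      exact ((measurable_eval_of_rightLocallyConstant hg hgr (by fun_prop)).sub
        (measurable_eval_of_rightLocallyConstant h₁ h₁r (by fun_prop))).sub
        (measurable_eval_of_rightLocallyConstant h₂ h₂r (by fun_prop))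
    have hd : Measurable fun ω => (S ω k).wait (g · ω) (n₁ · ω) (n₂ · ω) r₁ r₂ t := by
      simp only [ChainState.wait, dwellTime]
      -- Here the countability of the index set of the infimum is used.
      refine Measurable.iInf fun q => ?_
      refine Measurable.ite (measurableSet_eq_fun (hF _ measurable_const) hv) ?_ ?_
      · fun_prop
      · fun_prop
    refine ⟨hT.add hd, hF _ hd, hA.add (hr₁.mul hd), hB.add (hr₂.mul hd)⟩

/-- The σ-algebra is left free so that it can be the one generated by the data known at clock level
`a`. -/
theorem measurableSet_exists_lt_clock {g n₁ n₂ : ℝ≥0 → Ω → ℕ} (hg : ∀ s, Measurable (g s))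
    (h₁ : ∀ s, Measurable (n₁ s)) (h₂ : ∀ s, Measurable (n₂ s))
    (hgr : ∀ ω, RightLocallyConstant fun s => g s ω)
    (h₁r : ∀ ω, RightLocallyConstant fun s => n₁ s ω)
    (h₂r : ∀ ω, RightLocallyConstant fun s => n₂ s ω) (r₁ r₂ : ℕ → ℝ≥0) (t a : ℝ≥0) :
    MeasurableSet {ω | ∃ k, a < (jumpChain (g · ω) (n₁ · ω) (n₂ · ω) r₁ r₂ t k).clock₁} := by
  simp only [Set.ofPred_exists]
  exact MeasurableSet.iUnion fun k =>
    measurableSet_lt measurable_const (measurable_clock_jumpChain hg h₁ h₂ hgr h₁r h₂r r₁ r₂ t k)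

end

/-! ### Poisson means and the optional time identity -/

open scoped Nat in
-- The factor n cancels into n!, which shifts the series back to the total mass. The norm matches
-- `integrable_poissonMeasure_iff`.
theorem hasSum_poisson_mean (r : ℝ≥0) :
    HasSum (fun n : ℕ => Real.exp (-r) * r ^ n / n ! * ‖(n : ℝ)‖) (r : ℝ) := by
  rw [← hasSum_nat_add_iff' 1]
  have e : (fun n : ℕ => Real.exp (-r) * (r : ℝ) ^ (n + 1) / (n + 1)! * ‖((n + 1 : ℕ) : ℝ)‖) =
      fun n : ℕ => (r : ℝ) * (Real.exp (-r) * r ^ n / n !) := by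
    funext n
    rw [Nat.factorial_succ, Real.norm_of_nonneg (by positivity)]
    push_cast
    field_simp
    ring
  rw [e]
  simpa using (hasSum_one_poissonMeasure r).mul_left (r : ℝ)

theorem lintegral_natCast_poissonMeasure (r : ℝ≥0) :
    ∫⁻ n : ℕ, (n : ENNReal) ∂(poissonMeasure r) = r := by
  have hs := hasSum_poisson_mean r
  have hi : Integrable (fun n : ℕ => (n : ℝ)) (poissonMeasure r) :=
    integrable_poissonMeasure_iff.2 hs.summable
  have h := hasSum_integral_poissonMeasure hi
  have e : ∫ n : ℕ, (n : ℝ) ∂(poissonMeasure r) = r := by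
    refine h.unique ?_
    simpa using hs
  have := ofReal_integral_eq_lintegral_ofReal hi (Filter.Eventually.of_forall fun n => by simp)
  rw [e] at this
  simpa using this.symm

theorem tsum_ite_lt_eq_sum_range (c : ℕ → ENNReal) (K : ℕ) :
    ∑' k, (if k < K then c k else 0) = ∑ k ∈ Finset.range K, c k := by
  rw [tsum_eq_sum (s := Finset.range K) fun b hb => if_neg (by simpa using hb)]
  exact Finset.sum_congr rfl fun k hk => if_pos (by simpa using hk)

theorem tsum_ite_lt_increment {F : ℕ → ℕ} (hF : Monotone F) (h0 : F 0 = 0) (K : ℕ) :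
    ∑' k, (if k < K then ((F (k + 1) - F k : ℕ) : ENNReal) else 0) = F K := by
  rw [tsum_ite_lt_eq_sum_range, ← Nat.cast_sum, Finset.sum_range_tsub hF, h0, tsub_zero]

namespace IsStandardPoissonProcess

variable {Ω : Type*} [MeasurableSpace Ω] {P : Measure Ω} {N : ℝ≥0 → Ω → ℕ}

theorem rightLocallyConstant (hN : IsStandardPoissonProcess P N) (ω : Ω) :
    RightLocallyConstant fun s => N s ω :=
  rightLocallyConstant_of_continuousWithinAt (hN.rightCts ω)

theorem lintegral_increment (hN : IsStandardPoissonProcess P N) {s t : ℝ≥0} (h : s ≤ t) :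
    ∫⁻ ω, ((N t ω - N s ω : ℕ) : ENNReal) ∂P = (t - s : ℝ≥0) := by
  rw [(hN.law s t h).lintegral_comp (f := fun n : ℕ => (n : ENNReal))
    (measurable_of_countable _).aemeasurable, lintegral_natCast_poissonMeasure]

/-- `a < τ` is almost surely equal to an event that is independent of the increment of `N`
between `a` and `b`. -/
def IndepLaterIncrements (P : Measure Ω) (N : ℝ≥0 → Ω → ℕ) (τ : Ω → ℝ≥0) : Prop :=
  ∀ a b, a ≤ b → ∃ A : Set Ω, MeasurableSet A ∧ (∀ᵐ ω ∂P, ω ∈ A ↔ a < τ ω) ∧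
    IndepFun (A.indicator (1 : Ω → ENNReal)) (fun ω => N b ω - N a ω) P

/-- By independence the integral of the product factors, and the increment has mean `b - a`. -/
theorem lintegral_ite_mul_increment (hN : IsStandardPoissonProcess P N) {τ : Ω → ℝ≥0}
    (hτ : IndepLaterIncrements P N τ) {a b : ℝ≥0} (hab : a ≤ b) :
    ∫⁻ ω, (if a < τ ω then ((N b ω - N a ω : ℕ) : ENNReal) else 0) ∂P =
      ∫⁻ ω, (if a < τ ω then ((b - a : ℝ≥0) : ENNReal) else 0) ∂P := by
  obtain ⟨A, hA, hAτ, hind⟩ := hτ a b hab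
  have hm : Measurable fun ω => ((N b ω - N a ω : ℕ) : ENNReal) :=
    (measurable_of_countable fun n : ℕ => (n : ENNReal)).comp
      ((hN.measurable b).sub (hN.measurable a))
  have hmA : Measurable (A.indicator (1 : Ω → ENNReal)) := measurable_one.indicator hA
  calc _ = ∫⁻ ω, ((A.indicator 1 : Ω → ENNReal) * fun ω => ((N b ω - N a ω : ℕ) : ENNReal)) ω ∂P := by
        refine lintegral_congr_ae ?_
        filter_upwards [hAτ] with ω h
        by_cases hω : ω ∈ A
        · simp [hω, h.1 hω]
        · simp [hω, mt h.2 hω]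
    _ = (∫⁻ ω, A.indicator (1 : Ω → ENNReal) ω ∂P) * ∫⁻ ω, ((N b ω - N a ω : ℕ) : ENNReal) ∂P := by
        refine lintegral_mul_eq_lintegral_mul_lintegral_of_indepFun hmA hm ?_
        exact hind.comp measurable_id (measurable_of_countable fun n : ℕ => (n : ENNReal))
    _ = ∫⁻ ω, A.indicator (1 : Ω → ENNReal) ω * ((b - a : ℝ≥0) : ENNReal) ∂P := by
        rw [hN.lintegral_increment hab, lintegral_mul_const _ hmA]
    _ = _ := by
        refine lintegral_congr_ae ?_
        filter_upwards [hAτ] with ω h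
        by_cases hω : ω ∈ A
        · simp [hω, h.1 hω]
        · simp [hω, mt h.2 hω]

/-- Both sides telescope over the grid cells that begin before `τ`, and the cells are compared one
by one. With values in `ENNReal`, sum and integral commute without any integrability. -/
theorem lintegral_eval_gridAbove (hN : IsStandardPoissonProcess P N) {τ : Ω → ℝ≥0}
    (hτm : Measurable τ) (hτ : IndepLaterIncrements P N τ) (n : ℕ) :
    ∫⁻ ω, (N (gridAbove n (τ ω)) ω : ENNReal) ∂P = ∫⁻ ω, (gridAbove n (τ ω) : ENNReal) ∂P := by
  have hn : (0 : ℝ≥0) < n + 1 := by positivity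
  set p : ℕ → ℝ≥0 := fun k => (k : ℝ≥0) / (n + 1) with hp
  have hpm : Monotone p := fun i j hij => by simp only [hp]; gcongr
  have hlt : ∀ k ω, k < ⌈((n : ℝ≥0) + 1) * τ ω⌉₊ ↔ p k < τ ω := by
    intro k ω
    rw [Nat.lt_ceil, hp, div_lt_iff₀ hn, mul_comm]
  have hset : ∀ k, MeasurableSet {ω | p k < τ ω} := fun k => measurableSet_lt measurable_const hτm
  have hm : ∀ k, Measurable fun ω => ((N (p (k + 1)) ω - N (p k) ω : ℕ) : ENNReal) := fun k =>
    (measurable_of_countable fun n : ℕ => (n : ENNReal)).comp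
      ((hN.measurable _).sub (hN.measurable _))
  have e1 : ∀ ω, (N (gridAbove n (τ ω)) ω : ENNReal) =
      ∑' k, if p k < τ ω then ((N (p (k + 1)) ω - N (p k) ω : ℕ) : ENNReal) else 0 := by
    intro ω
    simp only [← hlt]
    rw [tsum_ite_lt_increment (F := fun k => N (p k) ω) (fun i j hij => hN.mono ω (hpm hij))
      (by simp [hp, hN.zero])]
    rfl
  have e2 : ∀ ω, (gridAbove n (τ ω) : ENNReal) =
      ∑' k, if p k < τ ω then ((p (k + 1) - p k : ℝ≥0) : ENNReal) else 0 := by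
    intro ω
    simp only [← hlt]
    rw [tsum_ite_lt_eq_sum_range, ← ENNReal.ofNNReal_finsetSum, Finset.sum_range_tsub hpm]
    simp [hp, gridAbove]
  simp only [e1, e2]
  rw [lintegral_tsum fun k => (Measurable.ite (hset k) (hm k) measurable_const).aemeasurable,
    lintegral_tsum fun k =>
      (Measurable.ite (hset k) measurable_const measurable_const).aemeasurable]
  exact tsum_congr fun k => hN.lintegral_ite_mul_increment hτ (hpm k.le_succ)

theorem measurable_gridAbove (n : ℕ) : Measurable (gridAbove n) := by
  have : Measurable fun s : ℝ≥0 => ⌈((n : ℝ≥0) + 1) * s⌉₊ := Nat.measurable_ceil.comp (by fun_prop)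
  exact ((measurable_of_countable fun k : ℕ => (k : ℝ≥0)).comp this).div_const _

theorem tendsto_gridAbove (s : ℝ≥0) :
    Filter.Tendsto (fun n => (gridAbove n s : ℝ)) Filter.atTop (nhds s) := by
  have h : Filter.Tendsto (fun n : ℕ => (s : ℝ) + 1 / ((n : ℝ) + 1)) Filter.atTop (nhds s) := by
    simpa using tendsto_one_div_add_atTop_nhds_zero_nat.const_add (s : ℝ)
  refine tendsto_of_tendsto_of_tendsto_of_le_of_le tendsto_const_nhds h
    (fun n => le_gridAbove n s) fun n => ?_
  have := gridAbove_le_add n s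
  rw [← NNReal.coe_le_coe] at this
  simpa using this

/-- The optional time identity: evaluating a Poisson process at an integrable optional time `τ`
gives a variable of the same mean as `τ`. -/
theorem integral_eval_of_measurable [IsProbabilityMeasure P] (hN : IsStandardPoissonProcess P N)
    {τ : Ω → ℝ≥0} (hτm : Measurable τ) (hτi : Integrable (fun ω => (τ ω : ℝ)) P)
    (hτ : IndepLaterIncrements P N τ) :
    Integrable (fun ω => (N (τ ω) ω : ℝ)) P ∧ ∫ ω, (N (τ ω) ω : ℝ) ∂P = ∫ ω, (τ ω : ℝ) ∂P := by
  have hcast : Measurable fun n : ℕ => (n : ℝ) := measurable_of_countable _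
  have hgm : ∀ n, Measurable fun ω => (gridAbove n (τ ω) : ℝ) := fun n =>
    ((measurable_gridAbove n).comp hτm).coe_nnreal_real
  have hNm : ∀ n, Measurable fun ω => (N (gridAbove n (τ ω)) ω : ℝ) := fun n =>
    hcast.comp (measurable_eval_gridAbove hN.measurable hτm n)
  have hg_le : ∀ n ω, (gridAbove n (τ ω) : ℝ) ≤ τ ω + 1 := by
    intro n ω
    have h1 := gridAbove_le_add n (τ ω)
    have h2 : (1 : ℝ≥0) / (n + 1) ≤ 1 := by
      rw [div_le_one (by positivity)]; exact le_add_self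
    exact_mod_cast h1.trans (by gcongr)
  have hbound : Integrable (fun ω => (τ ω : ℝ) + 1) P := hτi.add (integrable_const _)
  have hgi : ∀ n, Integrable (fun ω => (gridAbove n (τ ω) : ℝ)) P := fun n =>
    hbound.mono' (hgm n).aestronglyMeasurable (Filter.Eventually.of_forall fun ω => by
      rw [Real.norm_of_nonneg (NNReal.coe_nonneg _)]; exact hg_le n ω)
  have hlint : ∀ n, ∫⁻ ω, ENNReal.ofReal (N (gridAbove n (τ ω)) ω : ℝ) ∂P =
      ∫⁻ ω, ENNReal.ofReal (gridAbove n (τ ω) : ℝ) ∂P := by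
    intro n
    simpa using hN.lintegral_eval_gridAbove hτm hτ n
  have hNi : ∀ n, Integrable (fun ω => (N (gridAbove n (τ ω)) ω : ℝ)) P := by
    intro n
    refine ⟨(hNm n).aestronglyMeasurable, ?_⟩
    rw [hasFiniteIntegral_iff_ofReal (Filter.Eventually.of_forall fun ω => by positivity), hlint]
    exact (hasFiniteIntegral_iff_ofReal (Filter.Eventually.of_forall fun ω => by positivity)).1
      (hgi n).2
  have heq : ∀ n, ∫ ω, (N (gridAbove n (τ ω)) ω : ℝ) ∂P = ∫ ω, (gridAbove n (τ ω) : ℝ) ∂P := by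
    intro n
    rw [integral_eq_lintegral_of_nonneg_ae (Filter.Eventually.of_forall fun ω => by positivity)
      (hNm n).aestronglyMeasurable, integral_eq_lintegral_of_nonneg_ae
      (Filter.Eventually.of_forall fun ω => by positivity) (hgm n).aestronglyMeasurable, hlint]
  have hNle : ∀ n ω, N (gridAbove n (τ ω)) ω ≤ N (gridAbove 0 (τ ω)) ω := by
    intro n ω
    refine hN.mono ω ((gridAbove_le_ceil n _).trans ?_)
    simp [gridAbove]
  have hlimN : ∀ ω, Filter.Tendsto (fun n => (N (gridAbove n (τ ω)) ω : ℝ)) Filter.atTop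
      (nhds (N (τ ω) ω : ℝ)) := fun ω =>
    tendsto_const_nhds.congr'
      (((hN.rightLocallyConstant ω).eventually_gridAbove (τ ω)).mono
        fun n h => congrArg (Nat.cast (R := ℝ)) h.symm)
  -- Refine the grid on both sides of `heq`, dominated by the mesh `1` value and by `τ + 1`
  -- respectively.
  have t1 := tendsto_integral_of_dominated_convergence (μ := P)
    (fun ω => (N (gridAbove 0 (τ ω)) ω : ℝ))
    (fun n => (hNm n).aestronglyMeasurable) (hNi 0)
    (fun n => Filter.Eventually.of_forall fun ω => by
      rw [Real.norm_of_nonneg (by positivity)]; exact_mod_cast hNle n ω)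
    (Filter.Eventually.of_forall hlimN)
  have t2 := tendsto_integral_of_dominated_convergence (μ := P) (fun ω => (τ ω : ℝ) + 1)
    (fun n => (hgm n).aestronglyMeasurable) hbound
    (fun n => Filter.Eventually.of_forall fun ω => by
      rw [Real.norm_of_nonneg (by positivity)]; exact hg_le n ω)
    (Filter.Eventually.of_forall fun ω => tendsto_gridAbove (τ ω))
  simp only [heq] at t1
  refine ⟨?_, tendsto_nhds_unique t1 t2⟩
  refine (hNi 0).mono' (hcast.comp (measurable_eval_of_rightLocallyConstant hN.measurable
    hN.rightLocallyConstant hτm)).aestronglyMeasurable (Filter.Eventually.of_forall fun ω => ?_)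
  rw [Real.norm_of_nonneg (by positivity)]
  exact_mod_cast hN.mono ω (le_gridAbove 0 (τ ω))

/-- Paths of the queue are regular only almost surely, so its clocks are only a.e. measurable; a
measurable modification is used instead. -/
theorem integral_eval [IsProbabilityMeasure P] (hN : IsStandardPoissonProcess P N)
    {τ : Ω → ℝ≥0} (hτi : Integrable (fun ω => (τ ω : ℝ)) P)
    (hτ : IndepLaterIncrements P N τ) :
    Integrable (fun ω => (N (τ ω) ω : ℝ)) P ∧ ∫ ω, (N (τ ω) ω : ℝ) ∂P = ∫ ω, (τ ω : ℝ) ∂P := by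
  have hτm : AEMeasurable τ P := by
    simpa only [Real.toNNReal_coe] using hτi.aemeasurable.real_toNNReal
  obtain ⟨σ, hσ, e⟩ := hτm
  have eN : (fun ω => (N (σ ω) ω : ℝ)) =ᵐ[P] fun ω => (N (τ ω) ω : ℝ) := by
    filter_upwards [e] with ω h; rw [h]
  have eτ : (fun ω => (σ ω : ℝ)) =ᵐ[P] fun ω => (τ ω : ℝ) := by
    filter_upwards [e] with ω h; rw [h]
  have := hN.integral_eval_of_measurable hσ (hτi.congr eτ.symm) (by
    intro a b hab
    obtain ⟨A, hA, hAτ, hind⟩ := hτ a b hab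
    refine ⟨A, hA, ?_, hind⟩
    filter_upwards [hAτ, e] with ω h h'
    rwa [← h'])
  rwa [integral_congr_ae eN, integral_congr_ae eτ, integrable_congr eN] at this

end IsStandardPoissonProcess

theorem RightLocallyConstant.comp_monotone_continuous {α : Type*} {f : ℝ≥0 → α}
    (hf : RightLocallyConstant f) {L : ℝ≥0 → ℝ≥0} (hL : Monotone L) (hc : Continuous L) :
    RightLocallyConstant fun s => f (L s) := by
  intro s
  obtain ⟨ε, hε, h⟩ := hf (L s)
  obtain ⟨δ, hδ, h'⟩ := Metric.continuous_iff.1 hc s ε hε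
  refine ⟨⟨δ, hδ.le⟩, hδ, fun r hr => ?_⟩
  have hd := h' (s + r) (by
    rw [NNReal.dist_eq]
    push_cast
    rw [add_sub_cancel_left, abs_of_nonneg r.coe_nonneg]
    exact hr)
  have hle : L s ≤ L (s + r) := hL le_self_add
  have := h (L (s + r) - L s) (by
    rw [← NNReal.coe_lt_coe, NNReal.coe_sub hle]
    exact (le_abs_self _).trans_lt hd)
  rwa [add_tsub_cancel_of_le hle] at this

/-! ### Independence of the clock events from later increments -/

section Independence

variable {Ω : Type*} [MeasurableSpace Ω] {P : Measure Ω}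

/-- The hypotheses make the law of the triple a product of three measures, which may be regrouped.
-/
theorem indepFun_prodMk_left_of_prodMk_right [IsProbabilityMeasure P] {α β γ : Type*}
    [MeasurableSpace α] [MeasurableSpace β] [MeasurableSpace γ]
    {X : Ω → α} {U : Ω → β} {V : Ω → γ}
    (hX : Measurable X) (hU : Measurable U) (hV : Measurable V)
    (h : IndepFun X (fun ω => (U ω, V ω)) P) (h' : IndepFun U V P) :
    IndepFun (fun ω => (X ω, U ω)) V P := by
  have hXU : IndepFun X U P := h.comp measurable_id measurable_fst
  have := Measure.isProbabilityMeasure_map (μ := P) hX.aemeasurable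
  have := Measure.isProbabilityMeasure_map (μ := P) hU.aemeasurable
  have := Measure.isProbabilityMeasure_map (μ := P) hV.aemeasurable
  rw [indepFun_iff_map_prod_eq_prod_map_map (by fun_prop) (by fun_prop)] at h h' hXU ⊢
  rw [h'] at h
  rw [hXU]
  have e := Measure.prodAssoc_prod (μ := P.map X) (ν := P.map U) (τ := P.map V)
  have hm : P.map (fun ω => ((X ω, U ω), V ω)) =
      (P.map fun ω => (X ω, U ω, V ω)).map MeasurableEquiv.prodAssoc.symm := by
    rw [Measure.map_map (MeasurableEquiv.measurable _) (by fun_prop)]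
    rfl
  rw [hm, h, ← e, Measure.map_map (MeasurableEquiv.measurable _) (MeasurableEquiv.measurable _)]
  simp

/-- This puts finitely many past times into the form required by independence of increments: the
increment with index `K` is the one from `a` to `b`, and starting at 0 lets past values be recovered
as sums of earlier increments. -/
theorem exists_monotone_enumeration (I : Finset ℝ≥0) {a b : ℝ≥0} (hab : a ≤ b)
    (hI : ∀ s ∈ I, s ≤ a) : ∃ (t : ℕ → ℝ≥0) (K : ℕ), Monotone t ∧ t 0 = 0 ∧ t K = a ∧
      t (K + 1) = b ∧ ∀ s ∈ I, ∃ j ≤ K, t j = s := by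
  classical
  set J : Finset ℝ≥0 := insert 0 (insert a I) with hJ
  have hJa : ∀ x ∈ J, x ≤ a := by
    intro x hx
    simp only [hJ, Finset.mem_insert] at hx
    rcases hx with rfl | rfl | hx
    · exact zero_le
    · exact le_rfl
    · exact hI x hx
  obtain ⟨K, hK⟩ : ∃ K, J.card = K + 1 :=
    Nat.exists_eq_succ_of_ne_zero (Finset.card_ne_zero_of_mem (a := 0) (by simp [hJ]))
  set e := J.orderEmbOfFin hK
  set t : ℕ → ℝ≥0 := fun k => if h : k < K + 1 then e ⟨k, h⟩ else b with ht
  have hmem : ∀ x ∈ J, ∃ j ≤ K, t j = x := by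
    intro x hx
    have : x ∈ Set.range e := by rw [Finset.range_orderEmbOfFin]; exact hx
    obtain ⟨⟨j, hj⟩, rfl⟩ := this
    exact ⟨j, Nat.lt_succ_iff.1 hj, by simp only [ht, dif_pos hj]⟩
  have htJ : ∀ k ≤ K, t k ∈ J := by
    intro k hk
    simp only [ht, dif_pos (Nat.lt_succ_of_le hk)]
    exact Finset.orderEmbOfFin_mem J hK _
  have hmono : Monotone t := by
    intro i j hij
    by_cases hj : j < K + 1
    · simp only [ht, dif_pos hj, dif_pos (hij.trans_lt hj)]
      exact e.monotone hij
    · have : t j = b := by simp only [ht, dif_neg hj]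
      rw [this]
      by_cases hi : i < K + 1
      · exact (hJa _ (htJ i (Nat.lt_succ_iff.1 hi))).trans hab
      · simp only [ht, dif_neg hi, le_refl]
  refine ⟨t, K, hmono, ?_, ?_, by simp [ht], fun s hs => hmem s (by simp [hJ, hs])⟩
  · obtain ⟨j, -, hj⟩ := hmem 0 (by simp [hJ])
    exact le_antisymm (hj ▸ hmono (Nat.zero_le j)) zero_le
  · obtain ⟨j, hjK, hj⟩ := hmem a (by simp [hJ])
    exact le_antisymm (hJa _ (htJ K le_rfl)) (hj ▸ hmono hjK)

namespace IsStandardPoissonProcess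

/-- It suffices to treat finitely many times. The stopped values there are sums of increments before
`a`, which are jointly independent of the one from `a` to `b`. -/
theorem indepFun_past_increment [IsProbabilityMeasure P] {N : ℝ≥0 → Ω → ℕ}
    (hN : IsStandardPoissonProcess P N) {a b : ℝ≥0} (hab : a ≤ b) :
    IndepFun (fun ω (s : ℝ≥0) => N (min s a) ω) (fun ω => N b ω - N a ω) P := by
  classical
  refine IndepFun.process_indepFun (X := fun s ω => N (min s a) ω) (fun s => hN.measurable _)
    ((hN.measurable b).sub (hN.measurable a)) fun I => ?_
  obtain ⟨t, K, ht, h0, hK, hK1, hI⟩ := exists_monotone_enumeration (I.image (min · a)) hab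
    (by simp)
  have hind := hN.indepIncrements.nat ht
  have hsplit := hind.indepFun_finset (Finset.range K) {K} (by simp)
    fun i => (hN.measurable _).sub (hN.measurable _)
  have hj : ∀ s : I, ∃ j ≤ K, t j = min (s : ℝ≥0) a := fun s =>
    hI _ (Finset.mem_image_of_mem _ s.2)
  choose j hjK hj using hj
  have hφ : Measurable fun (v : Finset.range K → ℕ) (s : I) =>
      ∑ i : Finset.range K, if (i : ℕ) < j s then v i else 0 := by
    refine measurable_pi_lambda _ fun s => Finset.measurable_sum _ fun i _ => ?_
    split_ifs
    · exact measurable_pi_apply i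
    · exact measurable_const
  have := hsplit.comp hφ (measurable_pi_apply ⟨K, Finset.mem_singleton_self K⟩)
  convert this using 1
  · funext ω s
    simp only [Function.comp]
    rw [Finset.sum_coe_sort (Finset.range K)
      (fun i => if i < j s then N (t (i + 1)) ω - N (t i) ω else 0), ← Finset.sum_filter]
    have hf : (Finset.range K).filter (· < j s) = Finset.range (j s) := by
      ext i
      have := hjK s
      simp only [Finset.mem_filter, Finset.mem_range]
      omega
    rw [hf, Finset.sum_range_tsub (f := fun i => N (t i) ω) (fun i k hik => hN.mono ω (ht hik)),
      h0, hN.zero, tsub_zero, hj]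
  · funext ω
    simp [Function.comp, hK, hK1]

/-- If a queue is driven by independent Poisson processes, then the internal clock of a
departure process exceeds a level independently of the increments after that level. -/
theorem indepLaterIncrements_clock [IsProbabilityMeasure P] {N : Fin 3 → ℝ≥0 → Ω → ℕ}
    (hN : ∀ i, IsStandardPoissonProcess P (N i))
    (hind : iIndepFun (fun i ω (t : ℝ≥0) => N i t ω) P) {Q₀ : Ω → ℕ} (hQ₀ : Measurable Q₀)
    (hQind : IndepFun Q₀ (fun ω (i : Fin 3) (t : ℝ≥0) => N i t ω) P)
    {L : ℝ≥0 → ℝ≥0} (hL : Monotone L) (hLc : Continuous L) {i j : Fin 3} (hi : i ≠ 0)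
    (hij : i ≠ j) {r₁ r₂ : ℕ → ℝ≥0} {τ₁ τ₂ : ℝ≥0 → Ω → ℝ≥0} {Q : ℝ≥0 → Ω → ℕ}
    (hQ : ∀ᵐ ω ∂P, IsQueuePath (fun s => Q₀ ω + N 0 (L s) ω) (N i · ω) (N j · ω) r₁ r₂
      (τ₁ · ω) (τ₂ · ω) (Q · ω)) (t : ℝ≥0) :
    IndepLaterIncrements P (N i) (τ₁ t) := by
  intro a b hab
  have hNm : ∀ k, Measurable fun ω (t : ℝ≥0) => N k t ω := fun k =>
    measurable_pi_lambda _ fun t => (hN k).measurable t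
  have hdisj : IndepFun (fun ω => ((fun t => N 0 t ω), fun t => N j t ω))
      (fun ω (t : ℝ≥0) => N i t ω) P :=
    hind.indepFun_prodMk hNm 0 j i hi.symm hij.symm
  have h1 : IndepFun (fun ω => (Q₀ ω, (fun t => N 0 t ω), fun t => N j t ω))
      (fun ω (t : ℝ≥0) => N i t ω) P := by
    refine indepFun_prodMk_left_of_prodMk_right hQ₀ ((hNm 0).prodMk (hNm j)) (hNm i) ?_ hdisj
    exact hQind.comp (ψ := fun F : Fin 3 → ℝ≥0 → ℕ => ((F 0, F j), F i)) measurable_id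
      (by fun_prop)
  have hXm : Measurable fun ω => (Q₀ ω, (fun t => N 0 t ω), fun t => N j t ω) :=
    hQ₀.prodMk ((hNm 0).prodMk (hNm j))
  have hUm : Measurable fun ω (s : ℝ≥0) => N i (min s a) ω :=
    measurable_pi_lambda _ fun s => (hN i).measurable _
  have h2 := indepFun_prodMk_left_of_prodMk_right hXm hUm
    (((hN i).measurable b).sub ((hN i).measurable a))
    (h1.comp (ψ := fun F : ℝ≥0 → ℕ => ((fun s => F (min s a)), F b - F a)) measurable_id (by
      refine (measurable_pi_lambda _ fun s => measurable_pi_apply _).prodMk ?_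
      exact (measurable_pi_apply b).sub (measurable_pi_apply a)))
    ((hN i).indepFun_past_increment hab)
  -- `W` collects all that is known at clock level `a`: the initial value, the two other processes,
  -- and `N i` stopped at `a`. By `h2` it is independent of the later increment.
  set W := fun ω => ((Q₀ ω, (fun t => N 0 t ω), fun t => N j t ω), fun s => N i (min s a) ω)
  have hWm : Measurable W := hXm.prodMk hUm
  set A : Set Ω := {ω | ∃ k, a < (jumpChain (fun s => Q₀ ω + N 0 (L s) ω)
    (fun s => N i (min s a) ω) (N j · ω) r₁ r₂ t k).clock₁} with hA
  have hAW : MeasurableSet[MeasurableSpace.comap W inferInstance] A := by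
    have hW : Measurable[MeasurableSpace.comap W inferInstance] W := comap_measurable W
    refine measurableSet_exists_lt_clock (m := MeasurableSpace.comap W inferInstance)
      (g := fun s ω => Q₀ ω + N 0 (L s) ω) (n₁ := fun s ω => N i (min s a) ω) (n₂ := N j)
      (fun s => ?_) (fun s => ?_) (fun s => ?_) (fun ω => ?_) (fun ω => ?_)
      (fun ω => (hN j).rightLocallyConstant ω) r₁ r₂ t a
    · exact (show Measurable fun w : (ℕ × (ℝ≥0 → ℕ) × (ℝ≥0 → ℕ)) × (ℝ≥0 → ℕ) =>
        w.1.1 + w.1.2.1 (L s) by fun_prop).comp hW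
    · exact (show Measurable fun w : (ℕ × (ℝ≥0 → ℕ) × (ℝ≥0 → ℕ)) × (ℝ≥0 → ℕ) =>
        w.2 s by fun_prop).comp hW
    · exact (show Measurable fun w : (ℕ × (ℝ≥0 → ℕ) × (ℝ≥0 → ℕ)) × (ℝ≥0 → ℕ) =>
        w.1.2.2 s by fun_prop).comp hW
    · have := ((hN 0).rightLocallyConstant ω).comp_monotone_continuous hL hLc
      exact this.map₃ this this fun x _ _ => Q₀ ω + x
    · exact ((hN i).rightLocallyConstant ω).comp_min a
  obtain ⟨B, hB, hBA⟩ := hAW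
  refine ⟨A, hBA ▸ hWm hB, ?_, ?_⟩
  · filter_upwards [hQ] with ω h
    exact (h.lt_clock₁_iff t a).symm
  · have : A.indicator (1 : Ω → ENNReal) = B.indicator 1 ∘ W := by
      rw [← hBA]; rfl
    rw [this]
    exact h2.comp (measurable_one.indicator hB) measurable_id

end IsStandardPoissonProcess

end Independence

/-! ### Comparison of integral equations -/

theorem continuousOn_Ici_primitive {f : ℝ → ℝ}
    (hf : ∀ t, 0 ≤ t → IntervalIntegrable f volume 0 t) :
    ContinuousOn (fun t => ∫ s in (0 : ℝ)..t, f s) (Set.Ici 0) := by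
  intro s hs
  have hs : 0 ≤ s := hs
  have h := intervalIntegral.continuousOn_primitive_interval' (hf (s + 1) (by positivity))
    Set.left_mem_uIcc
  rw [Set.uIcc_of_le (by positivity)] at h
  refine (h s ⟨hs, by linarith⟩).mono_of_mem_nhdsWithin ?_
  rw [← Set.Ici_inter_Iic]
  exact Filter.inter_mem self_mem_nhdsWithin
    (mem_nhdsWithin_of_mem_nhds (Iic_mem_nhds (by linarith)))

theorem integral_sub_of_nonneg {f : ℝ → ℝ} (hf : ∀ t, 0 ≤ t → IntervalIntegrable f volume 0 t)
    {s t : ℝ} (hs : 0 ≤ s) (ht : 0 ≤ t) :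
    ∫ u in s..t, f u = (∫ u in (0 : ℝ)..t, f u) - ∫ u in (0 : ℝ)..s, f u :=
  (intervalIntegral.integral_interval_sub_left (hf t ht) (hf s hs)).symm

theorem primitive_monotoneOn {f : ℝ → ℝ} (hf : ∀ t, 0 ≤ t → IntervalIntegrable f volume 0 t)
    (h0 : ∀ s, 0 ≤ s → 0 ≤ f s) :
    MonotoneOn (fun t => ∫ s in (0 : ℝ)..t, f s) (Set.Ici 0) := by
  intro s hs t ht hst
  have hs : 0 ≤ s := hs
  have h1 := integral_sub_of_nonneg hf hs ht
  have h2 : 0 ≤ ∫ u in s..t, f u :=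
    intervalIntegral.integral_nonneg hst fun u hu => h0 u (hs.trans hu.1)
  change _ ≤ _
  linarith

/-- A primitive that cannot increase where it is positive is nonpositive. -/
theorem primitive_nonpos {W : ℝ → ℝ} (hW : ∀ t, 0 ≤ t → IntervalIntegrable W volume 0 t)
    (h : ∀ s, 0 ≤ s → 0 < ∫ u in (0 : ℝ)..s, W u → W s ≤ 0) (t : ℝ) (ht : 0 ≤ t) :
    ∫ u in (0 : ℝ)..t, W u ≤ 0 := by
  set D : ℝ → ℝ := fun t => ∫ u in (0 : ℝ)..t, W u with hD
  by_contra! hpos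
  have hcont : ContinuousOn D (Set.Icc 0 t) :=
    (continuousOn_Ici_primitive hW).mono Set.Icc_subset_Ici_self
  -- Take the last time before `t` at which the primitive is nonpositive. Afterwards it is positive,
  -- so the integrand is nonpositive up to `t`.
  set S : Set ℝ := Set.Icc 0 t ∩ D ⁻¹' Set.Iic 0 with hS
  have hclosed : IsClosed S := hcont.preimage_isClosed_of_isClosed isClosed_Icc isClosed_Iic
  have hcomp : IsCompact S := isCompact_Icc.of_isClosed_subset hclosed Set.inter_subset_left
  have hne : S.Nonempty := ⟨0, ⟨le_rfl, ht⟩, by simp [hD]⟩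
  obtain ⟨⟨h0, hst⟩, hDs⟩ := hcomp.sSup_mem hne
  set s := sSup S
  have hafter : ∀ u ∈ Set.Ioc s t, 0 < D u := by
    intro u hu
    by_contra! hu'
    exact absurd (le_csSup hcomp.bddAbove
      (show u ∈ S from ⟨⟨h0.trans hu.1.le, hu.2⟩, hu'⟩)) (not_le.2 hu.1)
  have e := integral_sub_of_nonneg hW h0 ht
  have hneg : ∫ u in s..t, W u ≤ 0 := by
    rw [intervalIntegral.integral_of_le hst]
    refine setIntegral_nonpos measurableSet_Ioc fun u hu => ?_
    exact h u (h0.trans hu.1.le) (hafter u hu)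
  have hDs : D s ≤ 0 := hDs
  have : D t ≤ 0 := by
    simp only [hD] at hDs ⊢
    linarith
  exact absurd this (not_le.2 hpos)

/-- The difference `u - v` is a primitive of `V - U`, to which `primitive_nonpos` applies. The rates
are arbitrary functions of time because E[D(Q)] is not a function of the mean. -/
theorem solution_comparison {lam u v U V : ℝ → ℝ}
    (hlam : ∀ t, 0 ≤ t → IntervalIntegrable lam volume 0 t)
    (hU : ∀ t, 0 ≤ t → IntervalIntegrable U volume 0 t)
    (hV : ∀ t, 0 ≤ t → IntervalIntegrable V volume 0 t)
    (hu : ∀ t, 0 ≤ t → u t = u 0 + ∫ s in (0 : ℝ)..t, (lam s - U s))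
    (hv : ∀ t, 0 ≤ t → v t = v 0 + ∫ s in (0 : ℝ)..t, (lam s - V s))
    (h0 : u 0 = v 0) (h : ∀ s, 0 ≤ s → v s < u s → V s ≤ U s) (t : ℝ) (ht : 0 ≤ t) :
    u t ≤ v t := by
  have key : ∀ t, 0 ≤ t → u t - v t = ∫ s in (0 : ℝ)..t, (V s - U s) := by
    intro t ht
    rw [hu t ht, hv t ht, h0, intervalIntegral.integral_sub (hlam t ht) (hU t ht),
      intervalIntegral.integral_sub (hlam t ht) (hV t ht),
      intervalIntegral.integral_sub (hV t ht) (hU t ht)]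
    ring
  have := primitive_nonpos (fun t ht => (hV t ht).sub (hU t ht)) (fun s hs hpos => by
    have := h s hs (by have := key s hs; linarith)
    linarith) t ht
  have := key t ht
  linarith

/-! ### Internal clocks and their means -/

/-- The internal clock of a departure process whose rate is `r x` while the queue length is `x`. -/
noncomputable def internalClock (r : ℕ → ℝ) (Q : ℝ≥0 → ℕ) (t : ℝ≥0) : ℝ≥0 :=
  (∫ s in (0 : ℝ)..t, r (Q s.toNNReal)).toNNReal

theorem RightLocallyConstant.measurable {Q : ℝ≥0 → ℕ} (hQ : RightLocallyConstant Q) :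
    Measurable Q :=
  measurable_eval_of_rightLocallyConstant (N := fun s _ => Q s) (fun _ => measurable_const)
    (fun _ => hQ) measurable_id

theorem intervalIntegrable_rate {r : ℕ → ℝ} {Q : ℝ≥0 → ℕ} (hQ : RightLocallyConstant Q)
    (hb : ∀ t, ∃ M, ∀ s ≤ t, Q s ≤ M) (t : ℝ) (ht : 0 ≤ t) :
    IntervalIntegrable (fun s => r (Q s.toNNReal)) volume 0 t := by
  obtain ⟨M, hM⟩ := hb t.toNNReal
  rw [intervalIntegrable_iff_integrableOn_Ioc_of_le ht]
  -- A bounded path takes finitely many values, so the sum of their rates is a bound.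
  refine Measure.integrableOn_of_bounded (M := ∑ k ∈ Finset.range (M + 1), ‖r k‖) (by simp)
    ((measurable_of_countable r).comp (hQ.measurable.comp measurable_real_toNNReal)).aestronglyMeasurable
    ?_
  filter_upwards [ae_restrict_mem measurableSet_Ioc] with s hs
  refine Finset.single_le_sum (f := fun k => ‖r k‖) (fun k _ => norm_nonneg _) ?_
  rw [Finset.mem_range]
  exact Nat.lt_succ_of_le (hM _ (Real.toNNReal_le_toNNReal hs.2))


theorem coe_internalClock {r : ℕ → ℝ} (hr : ∀ x, 0 ≤ r x) (Q : ℝ≥0 → ℕ) (t : ℝ≥0) :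
    (internalClock r Q t : ℝ) = ∫ s in (0 : ℝ)..t, r (Q s.toNNReal) :=
  Real.coe_toNNReal _ (intervalIntegral.integral_nonneg t.coe_nonneg fun _ _ => hr _)

theorem monotone_internalClock {r : ℕ → ℝ} (hr : ∀ x, 0 ≤ r x) {Q : ℝ≥0 → ℕ}
    (hQ : RightLocallyConstant Q) (hb : ∀ t, ∃ M, ∀ s ≤ t, Q s ≤ M) :
    Monotone (internalClock r Q) := fun s t hst =>
  Real.toNNReal_le_toNNReal
    (primitive_monotoneOn (intervalIntegrable_rate hQ hb) (fun _ _ => hr _) s.2 t.2 hst)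

theorem internalClock_add {r : ℕ → ℝ} (hr : ∀ x, 0 ≤ r x) {Q : ℝ≥0 → ℕ}
    (hQ : RightLocallyConstant Q) (hb : ∀ t, ∃ M, ∀ s ≤ t, Q s ≤ M) {s u : ℝ≥0} {x : ℕ}
    (hx : ∀ v < u, Q (s + v) = x) :
    internalClock r Q (s + u) = internalClock r Q s + (r x).toNNReal * u := by
  rw [← NNReal.coe_inj]
  push_cast
  rw [coe_internalClock hr, coe_internalClock hr, Real.coe_toNNReal _ (hr x),
    NNReal.coe_add]
  have h1 := integral_sub_of_nonneg (intervalIntegrable_rate (r := r) hQ hb) s.coe_nonneg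
    (s + u).coe_nonneg
  have h2 : ∫ v in (s : ℝ)..(s + u : ℝ≥0), r (Q v.toNNReal) =
      ∫ _ in (s : ℝ)..(s + u : ℝ≥0), r x := by
    refine intervalIntegral.integral_congr_Ioo_of_le (by simp) fun v hv => ?_
    have hsv : s ≤ v.toNNReal := NNReal.le_toNNReal_of_coe_le hv.1.le
    have := hx (v.toNNReal - s) (by
      rw [tsub_lt_iff_left hsv, Real.toNNReal_lt_iff_lt_coe (s.coe_nonneg.trans hv.1.le)]
      exact hv.2)
    rw [add_tsub_cancel_of_le hsv] at this
    simp only [this]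
  rw [intervalIntegral.integral_const] at h2
  push_cast at h1 h2
  rw [add_sub_cancel_left, smul_eq_mul] at h2
  linarith

section

variable {Ω : Type*} [MeasurableSpace Ω] {P : Measure Ω}

theorem IsStandardPoissonProcess.integrable_and_integral_eq {N : ℝ≥0 → Ω → ℕ}
    (hN : IsStandardPoissonProcess P N) (t : ℝ≥0) :
    Integrable (fun ω => (N t ω : ℝ)) P ∧ ∫ ω, (N t ω : ℝ) ∂P = t := by
  have hm : Measurable fun ω => (N t ω : ℝ) :=
    (measurable_of_countable fun n : ℕ => (n : ℝ)).comp (hN.measurable t)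
  have h := hN.lintegral_increment (zero_le (a := t))
  simp only [hN.zero, tsub_zero] at h
  have h' : ∫⁻ ω, ENNReal.ofReal (N t ω : ℝ) ∂P = t := by simpa using h
  have h0 : 0 ≤ᵐ[P] fun ω => (N t ω : ℝ) := Filter.Eventually.of_forall fun ω => by positivity
  refine ⟨⟨hm.aestronglyMeasurable, ?_⟩, ?_⟩
  · rw [hasFiniteIntegral_iff_ofReal h0, h']
    exact ENNReal.coe_lt_top
  · rw [integral_eq_lintegral_of_nonneg_ae h0 hm.aestronglyMeasurable, h', ENNReal.coe_toReal]

/-- Joint measurability, needed for Fubini, comes from the grid approximation in the time variable.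
-/
theorem aemeasurable_uncurry_path [SFinite P] {Q : ℝ≥0 → Ω → ℕ} (hQm : ∀ t, Measurable (Q t))
    (hQ : ∀ᵐ ω ∂P, RightLocallyConstant (Q · ω)) (ν : Measure ℝ) [SFinite ν] :
    AEMeasurable (fun p : ℝ × Ω => Q p.1.toNNReal p.2) (ν.prod P) := by
  refine aemeasurable_of_tendsto_metrizable_ae Filter.atTop
    (f := fun n (p : ℝ × Ω) => Q (gridAbove n p.1.toNNReal) p.2) (fun n => ?_) ?_
  · exact (measurable_eval_gridAbove (N := fun s (p : ℝ × Ω) => Q s p.2)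
      (fun s => (hQm s).comp measurable_snd)
      (measurable_real_toNNReal.comp measurable_fst) n).aemeasurable
  · filter_upwards [Measure.quasiMeasurePreserving_snd.ae hQ] with p hp
    exact tendsto_const_nhds.congr'
      ((hp.eventually_gridAbove p.1.toNNReal).mono fun n h => h.symm)

theorem integrable_uncurry_rate [SFinite P] {Q : ℝ≥0 → Ω → ℕ} (hQm : ∀ t, Measurable (Q t))
    (hQ : ∀ᵐ ω ∂P, RightLocallyConstant (Q · ω)) {t : ℝ} {B : Ω → ℝ} (hB : Integrable B P)
    (hQB : ∀ᵐ ω ∂P, ∀ s : ℝ≥0, (s : ℝ) ≤ t → (Q s ω : ℝ) ≤ B ω) {r : ℕ → ℝ} {C : ℝ}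
    (hr : ∀ x, 0 ≤ r x ∧ r x ≤ C * x) (hC : 0 ≤ C) :
    Integrable (fun p : ℝ × Ω => r (Q p.1.toNNReal p.2))
      ((volume.restrict (Set.Ioc 0 t)).prod P) := by
  have hm := (measurable_of_countable r).comp_aemeasurable
    (aemeasurable_uncurry_path hQm hQ (volume.restrict (Set.Ioc 0 t)))
  refine ((hB.const_mul C).comp_snd (volume.restrict (Set.Ioc 0 t))).mono'
    hm.aestronglyMeasurable ?_
  filter_upwards [Measure.quasiMeasurePreserving_snd.ae hQB,
    Measure.quasiMeasurePreserving_fst.ae (ae_restrict_mem (μ := volume)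
      (measurableSet_Ioc (a := (0 : ℝ)) (b := t)))] with p hp hp1
  rw [Real.norm_of_nonneg (hr _).1]
  refine (hr _).2.trans (mul_le_mul_of_nonneg_left (hp _ ?_) hC)
  rw [Real.coe_toNNReal _ hp1.1.le]
  exact hp1.2

theorem integral_internalClock [SFinite P] {Q : ℝ≥0 → Ω → ℕ} {t : ℝ≥0} {r : ℕ → ℝ}
    (hr : ∀ x, 0 ≤ r x) (h : Integrable (fun p : ℝ × Ω => r (Q p.1.toNNReal p.2))
      ((volume.restrict (Set.Ioc 0 (t : ℝ))).prod P)) :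
    Integrable (fun ω => (internalClock r (Q · ω) t : ℝ)) P ∧
      ∫ ω, (internalClock r (Q · ω) t : ℝ) ∂P =
        ∫ s in (0 : ℝ)..t, ∫ ω, r (Q s.toNNReal ω) ∂P := by
  simp only [coe_internalClock hr, intervalIntegral.integral_of_le t.coe_nonneg]
  exact ⟨h.integral_prod_right,
    (integral_integral_swap (f := fun (s : ℝ) ω => r (Q s.toNNReal ω)) h).symm⟩

end

/-! ### The equation for the mean queue length -/

namespace IsErlangAQueue

variable {Ω : Type*} [MeasurableSpace Ω] {P : Measure Ω} {lam : ℝ → ℝ} {c : ℕ} {μ θ : ℝ}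
  {Q : ℝ≥0 → Ω → ℕ}

/-- The total service rate when the queue length is `x`. -/
noncomputable def serviceRate (c : ℕ) (μ : ℝ) (x : ℕ) : ℝ := μ * min (x : ℝ) c

/-- The total abandonment rate when the queue length is `x`. -/
noncomputable def abandonRate (c : ℕ) (θ : ℝ) (x : ℕ) : ℝ := θ * max ((x : ℝ) - c) 0

theorem serviceRate_bounds (hμ : 0 ≤ μ) (c x : ℕ) :
    0 ≤ serviceRate c μ x ∧ serviceRate c μ x ≤ μ * x :=
  ⟨mul_nonneg hμ (le_min (by positivity) (by positivity)),
    mul_le_mul_of_nonneg_left (min_le_left _ _) hμ⟩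

theorem abandonRate_bounds (hθ : 0 ≤ θ) (c x : ℕ) :
    0 ≤ abandonRate c θ x ∧ abandonRate c θ x ≤ θ * x :=
  ⟨mul_nonneg hθ (le_max_right _ _),
    mul_le_mul_of_nonneg_left (max_le (by simp) (by positivity)) hθ⟩

/-- The cumulative arrival intensity. -/
noncomputable def cumulativeIntensity (lam : ℝ → ℝ) (t : ℝ≥0) : ℝ≥0 :=
  (∫ s in (0 : ℝ)..t, lam s).toNNReal

theorem coe_cumulativeIntensity (hlam : ∀ t : ℝ, 0 ≤ t → 0 ≤ lam t) (t : ℝ≥0) :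
    (cumulativeIntensity lam t : ℝ) = ∫ s in (0 : ℝ)..t, lam s :=
  Real.coe_toNNReal _ (intervalIntegral.integral_nonneg t.coe_nonneg fun _ h => hlam _ h.1)

theorem monotone_cumulativeIntensity (hlam : ∀ t : ℝ, 0 ≤ t → 0 ≤ lam t)
    (hlam_int : ∀ t : ℝ, 0 ≤ t → IntervalIntegrable lam volume 0 t) :
    Monotone (cumulativeIntensity lam) := fun s t hst =>
  Real.toNNReal_le_toNNReal (primitive_monotoneOn hlam_int hlam s.coe_nonneg t.coe_nonneg hst)

theorem continuous_cumulativeIntensity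
    (hlam_int : ∀ t : ℝ, 0 ≤ t → IntervalIntegrable lam volume 0 t) :
    Continuous (cumulativeIntensity lam) :=
  continuous_real_toNNReal.comp ((continuousOn_Ici_primitive hlam_int).comp_continuous
    NNReal.continuous_coe fun t => t.coe_nonneg)

theorem ae_isQueuePath (hlam : ∀ t : ℝ, 0 ≤ t → 0 ≤ lam t)
    (hlam_int : ∀ t : ℝ, 0 ≤ t → IntervalIntegrable lam volume 0 t) (hμ : 0 ≤ μ) (hθ : 0 ≤ θ)
    (hQ : ∀ᵐ ω ∂P, ∀ t, ContinuousWithinAt (fun s => Q s ω) (Set.Ici t) t)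
    {N : Fin 3 → ℝ≥0 → Ω → ℕ} (hN : ∀ i, IsStandardPoissonProcess P (N i))
    (heq : ∀ᵐ ω ∂P, ∀ t : ℝ≥0, (Q t ω : ℝ) = (Q 0 ω : ℝ) + N 0 (cumulativeIntensity lam t) ω
      - N 1 (internalClock (serviceRate c μ) (Q · ω) t) ω
      - N 2 (internalClock (abandonRate c θ) (Q · ω) t) ω) :
    ∀ᵐ ω ∂P, IsQueuePath (fun s => Q 0 ω + N 0 (cumulativeIntensity lam s) ω)
      (N 1 · ω) (N 2 · ω) (fun x => (serviceRate c μ x).toNNReal)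
      (fun x => (abandonRate c θ x).toNNReal) (internalClock (serviceRate c μ) (Q · ω))
      (internalClock (abandonRate c θ) (Q · ω)) (Q · ω) := by
  filter_upwards [hQ, heq] with ω hQ heq
  have hL := monotone_cumulativeIntensity hlam hlam_int
  have hmono : Monotone fun s => Q 0 ω + N 0 (cumulativeIntensity lam s) ω :=
    fun s t hst => Nat.add_le_add_left ((hN 0).mono ω (hL hst)) _
  -- The additive form in ℕ shows that the subtractions in `IsQueuePath` do not truncate, and it
  -- bounds the path by initial content plus arrivals.
  have heq' : ∀ t, Q t ω + N 1 (internalClock (serviceRate c μ) (Q · ω) t) ω +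
      N 2 (internalClock (abandonRate c θ) (Q · ω) t) ω =
      Q 0 ω + N 0 (cumulativeIntensity lam t) ω := by
    intro t
    have := heq t
    rw [← Nat.cast_inj (R := ℝ)]
    push_cast
    linarith
  have hrlc : RightLocallyConstant (Q · ω) := rightLocallyConstant_of_continuousWithinAt hQ
  have hb : ∀ t, ∃ M, ∀ s ≤ t, Q s ω ≤ M := fun t =>
    ⟨Q 0 ω + N 0 (cumulativeIntensity lam t) ω, fun s hs => by
      have := heq' s
      have := hmono hs
      simp only at this
      omega⟩
  have hN0 := ((hN 0).rightLocallyConstant ω).comp_monotone_continuous hL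
    (continuous_cumulativeIntensity hlam_int)
  have hs := fun x => (serviceRate_bounds hμ c x).1
  have ha := fun x => (abandonRate_bounds hθ c x).1
  exact
    { rlc_arrival := hN0.map₃ hN0 hN0 fun x _ _ => Q 0 ω + x
      rlc₁ := (hN 1).rightLocallyConstant ω
      rlc₂ := (hN 2).rightLocallyConstant ω
      rlc := hrlc
      mono_arrival := hmono
      mono₁ := (hN 1).mono ω
      mono₂ := (hN 2).mono ω
      mono_clock₁ := monotone_internalClock hs hrlc hb
      mono_clock₂ := monotone_internalClock ha hrlc hb
      clock₁_zero := by simp [internalClock]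
      clock₂_zero := by simp [internalClock]
      clock₁_add := fun s r x hx => internalClock_add hs hrlc hb hx
      clock₂_add := fun s r x hx => internalClock_add ha hrlc hb hx
      eq := fun s => by have := heq' s; omega }

/-- The mean of the queue length solves the fluid equation with the mean departure rate. -/
theorem mean_eq [IsProbabilityMeasure P] (hlam : ∀ t : ℝ, 0 ≤ t → 0 ≤ lam t)
    (hlam_int : ∀ t : ℝ, 0 ≤ t → IntervalIntegrable lam volume 0 t) (hμ : 0 ≤ μ) (hθ : 0 ≤ θ)
    (hQ : IsErlangAQueue P lam c μ θ Q) (hQ0 : Integrable (fun ω => (Q 0 ω : ℝ)) P) (t : ℝ≥0) :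
    Integrable (fun ω => (Q t ω : ℝ)) P ∧
    IntervalIntegrable (fun s => ∫ ω, (serviceRate c μ (Q s.toNNReal ω) +
      abandonRate c θ (Q s.toNNReal ω)) ∂P) volume 0 t ∧
    ∫ ω, (Q t ω : ℝ) ∂P = ∫ ω, (Q 0 ω : ℝ) ∂P + ∫ s in (0 : ℝ)..t, (lam s -
      ∫ ω, (serviceRate c μ (Q s.toNNReal ω) + abandonRate c θ (Q s.toNNReal ω)) ∂P) := by
  obtain ⟨N, hN, hind, hQind, heq⟩ := hQ.timeChange
  change ∀ᵐ ω ∂P, ∀ t : ℝ≥0, (Q t ω : ℝ) = (Q 0 ω : ℝ) + N 0 (cumulativeIntensity lam t) ω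
      - N 1 (internalClock (serviceRate c μ) (Q · ω) t) ω
      - N 2 (internalClock (abandonRate c θ) (Q · ω) t) ω at heq
  have hL := monotone_cumulativeIntensity hlam hlam_int
  have hLc := continuous_cumulativeIntensity hlam_int
  have hpath := ae_isQueuePath hlam hlam_int hμ hθ hQ.rightCts hN heq
  have hrlc : ∀ᵐ ω ∂P, RightLocallyConstant (Q · ω) := hpath.mono fun ω h => h.rlc
  obtain ⟨hN0i, hN0⟩ := (hN 0).integrable_and_integral_eq (cumulativeIntensity lam t)
  have hB := hQ0.add hN0i
  -- The initial content plus the arrivals up to `t` is one integrable bound for all earlier times.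
  have hQB : ∀ᵐ ω ∂P, ∀ s : ℝ≥0, (s : ℝ) ≤ t →
      (Q s ω : ℝ) ≤ Q 0 ω + N 0 (cumulativeIntensity lam t) ω := by
    filter_upwards [hpath] with ω h s hs
    have h1 := h.eq s
    have h2 := h.mono_arrival (show s ≤ t from hs)
    exact_mod_cast (show Q s ω ≤ Q 0 ω + N 0 (cumulativeIntensity lam t) ω by omega)
  have hQi : Integrable (fun ω => (Q t ω : ℝ)) P := by
    refine hB.mono' ((measurable_of_countable fun n : ℕ => (n : ℝ)).comp
      (hQ.measurable t)).aestronglyMeasurable ?_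
    filter_upwards [hQB] with ω h
    rw [Real.norm_of_nonneg (by positivity)]
    exact h t le_rfl
  have hsb := serviceRate_bounds hμ c
  have hab := abandonRate_bounds hθ c
  have hF₁ := integrable_uncurry_rate hQ.measurable hrlc hB hQB hsb hμ
  have hF₂ := integrable_uncurry_rate hQ.measurable hrlc hB hQB hab hθ
  have hF₃ := hF₁.add hF₂
  obtain ⟨hC₁i, hC₁⟩ := integral_internalClock (fun x => (hsb x).1) hF₁
  obtain ⟨hC₂i, hC₂⟩ := integral_internalClock (fun x => (hab x).1) hF₂
  obtain ⟨hD₁i, hD₁⟩ := (hN 1).integral_eval hC₁i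
    (IsStandardPoissonProcess.indepLaterIncrements_clock hN hind (hQ.measurable 0) hQind hL hLc
      (by decide) (j := 2) (by decide)
      (τ₁ := fun s ω => internalClock (serviceRate c μ) (Q · ω) s)
      (τ₂ := fun s ω => internalClock (abandonRate c θ) (Q · ω) s) hpath t)
  obtain ⟨hD₂i, hD₂⟩ := (hN 2).integral_eval hC₂i
    (IsStandardPoissonProcess.indepLaterIncrements_clock hN hind (hQ.measurable 0) hQind hL hLc
      (by decide) (j := 1) (by decide)
      (τ₁ := fun s ω => internalClock (abandonRate c θ) (Q · ω) s)
      (τ₂ := fun s ω => internalClock (serviceRate c μ) (Q · ω) s)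
      (hpath.mono fun ω h => h.swap) t)
  have hi₁ : IntervalIntegrable (fun s => ∫ ω, serviceRate c μ (Q s.toNNReal ω) ∂P) volume 0 t :=
    (intervalIntegrable_iff_integrableOn_Ioc_of_le t.coe_nonneg).2 hF₁.integral_prod_left
  have hi₂ : IntervalIntegrable (fun s => ∫ ω, abandonRate c θ (Q s.toNNReal ω) ∂P) volume 0 t :=
    (intervalIntegrable_iff_integrableOn_Ioc_of_le t.coe_nonneg).2 hF₂.integral_prod_left
  have hi₃ : IntervalIntegrable (fun s => ∫ ω, (serviceRate c μ (Q s.toNNReal ω) +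
      abandonRate c θ (Q s.toNNReal ω)) ∂P) volume 0 t :=
    (intervalIntegrable_iff_integrableOn_Ioc_of_le t.coe_nonneg).2 hF₃.integral_prod_left
  refine ⟨hQi, hi₃, ?_⟩
  have hsplit : ∫ s in (0 : ℝ)..t, ∫ ω, (serviceRate c μ (Q s.toNNReal ω) +
      abandonRate c θ (Q s.toNNReal ω)) ∂P =
      (∫ s in (0 : ℝ)..t, ∫ ω, serviceRate c μ (Q s.toNNReal ω) ∂P) +
        ∫ s in (0 : ℝ)..t, ∫ ω, abandonRate c θ (Q s.toNNReal ω) ∂P := by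
    rw [← intervalIntegral.integral_add hi₁ hi₂, intervalIntegral.integral_of_le t.coe_nonneg,
      intervalIntegral.integral_of_le t.coe_nonneg]
    refine integral_congr_ae ?_
    filter_upwards [hF₁.prod_right_ae, hF₂.prod_right_ae] with s h₁ h₂
    exact integral_add h₁ h₂
  rw [intervalIntegral.integral_sub (hlam_int t t.coe_nonneg) hi₃, hsplit, ← hC₁, ← hC₂, ← hD₁,
    ← hD₂, ← coe_cumulativeIntensity hlam, ← hN0]
  have : ∫ ω, (Q t ω : ℝ) ∂P = ∫ ω, ((Q 0 ω : ℝ) + N 0 (cumulativeIntensity lam t) ω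
      - N 1 (internalClock (serviceRate c μ) (Q · ω) t) ω
      - N 2 (internalClock (abandonRate c θ) (Q · ω) t) ω) ∂P :=
    integral_congr_ae (heq.mono fun ω h => h t)
  rw [this, integral_sub (by exact (hQ0.add hN0i).sub hD₁i) hD₂i,
    integral_sub (by exact hQ0.add hN0i) hD₁i, integral_add hQ0 hN0i]
  ring

end IsErlangAQueue

/-! ### Jensen's inequality for the departure rate, and the conclusion -/

section DepartureRate

variable {c : ℕ} {μ θ : ℝ}

/-- The total departure rate at the queue length `x`. -/
noncomputable def departureRate (c : ℕ) (μ θ x : ℝ) : ℝ := μ * min x c + θ * max (x - c) 0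

theorem departureRate_mono (c : ℕ) (hμ : 0 ≤ μ) (hθ : 0 ≤ θ) :
    Monotone (departureRate c μ θ) := by
  intro x y hxy
  unfold departureRate
  gcongr

/-- The two lines have slopes `μ` and `θ` and cross at `c`; this is the concavity of the rate, in
the form used for Jensen's inequality. -/
theorem departureRate_eq_min (c : ℕ) (h : θ ≤ μ) (x : ℝ) :
    departureRate c μ θ x = min (μ * x) (μ * c + θ * (x - c)) := by
  unfold departureRate
  rcases le_total x c with hx | hx
  · rw [min_eq_left hx, max_eq_right (by linarith), min_eq_left (by nlinarith)]
    ring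
  · rw [min_eq_right hx, max_eq_left (by linarith), min_eq_right (by nlinarith)]

theorem departureRate_eq_max (c : ℕ) (h : μ ≤ θ) (x : ℝ) :
    departureRate c μ θ x = max (μ * x) (μ * c + θ * (x - c)) := by
  unfold departureRate
  rcases le_total x c with hx | hx
  · rw [min_eq_left hx, max_eq_right (by linarith), max_eq_left (by nlinarith)]
    ring
  · rw [min_eq_right hx, max_eq_left (by linarith), max_eq_right (by nlinarith)]

variable {Ω : Type*} [MeasurableSpace Ω] {P : Measure Ω} [IsProbabilityMeasure P]

theorem integral_affine {X : Ω → ℝ} (hX : Integrable X P) (a b : ℝ) :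
    ∫ ω, (a + b * (X ω - c)) ∂P = a + b * ((∫ ω, X ω ∂P) - c) := by
  rw [integral_add (integrable_const _) (by exact (hX.sub (integrable_const _)).const_mul _),
    integral_const_mul, integral_sub hX (integrable_const _)]
  simp

theorem integrable_departureRate {X : Ω → ℝ} (hX : Integrable X P) (c : ℕ) (μ θ : ℝ) :
    Integrable (fun ω => departureRate c μ θ (X ω)) P :=
  ((hX.inf (integrable_const (c : ℝ))).const_mul μ).add
    ((hX.sub (integrable_const (c : ℝ))).pos_part.const_mul θ)

/-- Jensen's inequality by hand: integrate the bound by each of the two affine functions. -/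
theorem integral_departureRate_le {X : Ω → ℝ} (hX : Integrable X P) (c : ℕ) (h : θ ≤ μ) :
    ∫ ω, departureRate c μ θ (X ω) ∂P ≤ departureRate c μ θ (∫ ω, X ω ∂P) := by
  have hi := integrable_departureRate hX c μ θ
  rw [departureRate_eq_min c h]
  refine le_min ?_ ?_
  · rw [← integral_const_mul]
    refine integral_mono hi (hX.const_mul μ) fun ω => ?_
    simp only [departureRate_eq_min c h]
    exact min_le_left _ _
  · rw [← integral_affine hX]
    refine integral_mono hi ((integrable_const _).add
      ((hX.sub (integrable_const _)).const_mul _)) fun ω => ?_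
    simp only [departureRate_eq_min c h]
    exact min_le_right _ _

theorem le_integral_departureRate {X : Ω → ℝ} (hX : Integrable X P) (c : ℕ) (h : μ ≤ θ) :
    departureRate c μ θ (∫ ω, X ω ∂P) ≤ ∫ ω, departureRate c μ θ (X ω) ∂P := by
  have hi := integrable_departureRate hX c μ θ
  rw [departureRate_eq_max c h]
  refine max_le ?_ ?_
  · rw [← integral_const_mul]
    refine integral_mono (hX.const_mul μ) hi fun ω => ?_
    simp only [departureRate_eq_max c h]
    exact le_max_left _ _
  · rw [← integral_affine hX]
    refine integral_mono ((integrable_const _).add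
      ((hX.sub (integrable_const _)).const_mul _)) hi fun ω => ?_
    simp only [departureRate_eq_max c h]
    exact le_max_right _ _

end DepartureRate

theorem theorem1 {Ω : Type*} [MeasurableSpace Ω] (P : Measure Ω) [IsProbabilityMeasure P]
    (lam : ℝ → ℝ) (hlam : ∀ t : ℝ, 0 ≤ t → 0 ≤ lam t)
    (hlam_int : ∀ t : ℝ, 0 ≤ t → IntervalIntegrable lam volume 0 t)
    (c : ℕ) (hc : 0 < c) (μ θ : ℝ) (hμ : 0 < μ) (hθ : 0 ≤ θ)
    (Q : ℝ≥0 → Ω → ℕ) (hQ : IsErlangAQueue P lam c μ θ Q)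
    (hQ0 : Integrable (fun ω => (Q 0 ω : ℝ)) P)
    (q : ℝ → ℝ) (hq : IsFluidMean lam c μ θ q)
    (h0 : q 0 = ∫ ω, (Q 0 ω : ℝ) ∂P) :
    (∀ t : ℝ≥0, Integrable (fun ω => (Q t ω : ℝ)) P) ∧
    (θ < μ → ∀ t : ℝ≥0, q t ≤ ∫ ω, (Q t ω : ℝ) ∂P) ∧
    (μ < θ → ∀ t : ℝ≥0, ∫ ω, (Q t ω : ℝ) ∂P ≤ q t) ∧
    (θ = μ → ∀ t : ℝ≥0, ∫ ω, (Q t ω : ℝ) ∂P = q t) := by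
  have hmean := hQ.mean_eq hlam hlam_int hμ.le hθ hQ0
  set m : ℝ → ℝ := fun t => ∫ ω, (Q t.toNNReal ω : ℝ) ∂P with hm
  set V : ℝ → ℝ := fun s => ∫ ω, departureRate c μ θ (Q s.toNNReal ω) ∂P with hV
  set U : ℝ → ℝ := fun s => departureRate c μ θ (q s) with hU
  have hVi : ∀ t, 0 ≤ t → IntervalIntegrable V volume 0 t := fun t ht => by
    have := (hmean t.toNNReal).2.1
    rw [Real.coe_toNNReal t ht] at this
    exact this
  have hUi : ∀ t, 0 ≤ t → IntervalIntegrable U volume 0 t := fun t ht => by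
    have hqc : ContinuousOn q (Set.uIcc 0 t) :=
      hq.continuousOn.mono (by rw [Set.uIcc_of_le ht]; exact Set.Icc_subset_Ici_self)
    refine ContinuousOn.intervalIntegrable ?_
    simp only [hU, departureRate]
    fun_prop
  have hmeq : ∀ t, 0 ≤ t → m t = m 0 + ∫ s in (0 : ℝ)..t, (lam s - V s) := fun t ht => by
    have := (hmean t.toNNReal).2.2
    rw [Real.coe_toNNReal t ht] at this
    simp only [hm, Real.toNNReal_zero]
    exact this
  have hqeq : ∀ t, 0 ≤ t → q t = q 0 + ∫ s in (0 : ℝ)..t, (lam s - U s) := fun t ht => by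
    rw [hq.integralEq t ht]
    simp only [hU, departureRate, sub_sub]
  have hm0 : q 0 = m 0 := by simp only [hm, Real.toNNReal_zero]; exact h0
  have hint : ∀ t : ℝ≥0, Integrable (fun ω => (Q t ω : ℝ)) P := fun t => (hmean t).1
  have hmt : ∀ t : ℝ≥0, m t = ∫ ω, (Q t ω : ℝ) ∂P := fun t => by simp only [hm, Real.toNNReal_coe]
  have hmono := departureRate_mono c hμ.le hθ
  have hlower : θ ≤ μ → ∀ t : ℝ≥0, q t ≤ ∫ ω, (Q t ω : ℝ) ∂P := fun h t => by
    rw [← hmt]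
    -- Where m < q, Jensen and monotonicity give E[D(Q)] ≤ D(m) ≤ D(q).
    exact solution_comparison hlam_int hUi hVi hqeq hmeq hm0
      (fun s _ hs => (integral_departureRate_le (hint _) c h).trans (hmono hs.le)) t t.coe_nonneg
  have hupper : μ ≤ θ → ∀ t : ℝ≥0, ∫ ω, (Q t ω : ℝ) ∂P ≤ q t := fun h t => by
    rw [← hmt]
    exact solution_comparison hlam_int hVi hUi hmeq hqeq hm0.symm
      (fun s _ hs => (hmono hs.le).trans (le_integral_departureRate (hint _) c h)) t t.coe_nonneg
  exact ⟨hint, fun h => hlower h.le, fun h => hupper h.le,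
    fun h t => le_antisymm (hupper h.ge t) (hlower h.le t)⟩
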